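/- **Theorem 3.9.** Let $(\mathsf G,\mathsf X)$ be a Shimura datum: $\mathsf G$ is a connected reductive group over $\mathbb Q$ and $\mathsf X$ is a $\mathsf G(\mathbb R)$-conjugacy class of homomorphisms $\mathbb S=\mathrm{Res}_{\mathbb C/\mathbb R}\mathbb G_m\to\mathsf G_{\mathbb R}$ satisfying Deligne's axioms (SV1)–(SV3). Let $\mathsf F$ be a totally real number field that is Galois over $\mathbb Q$, with group $\Gamma=\mathrm{Gal}(\mathsf F/\mathbb Q)$. Let $\mathsf H=\mathrm{Res}_{\mathsf F/\mathbb Q}\mathsf G_{\mathsf F}$, with its natural action of $\Gamma$, and let $\mathsf Y$ be the $\mathsf H(\mathbb R)$-conjugacy class of the composites $\mathbb S\xrightarrow{h}\mathsf G_{\mathbb R}\to\mathsf H_{\mathbb R}$ with $h\in\mathsf X$; it is stable under $\Gamma$. Let $\mathbb A_f$ denote the finite adeles of $\mathbb Q$. For a number field $k$ put $$\text{Ш}^1(k,\mathsf G)=\ker\Big(H^1(k,\mathsf G)\to\prod_v H^1(k_v,\mathsf G)\Big),$$ the product over all places $v$ of $k$, finite and infinite. Let $K\subset\mathsf H(\mathbb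 A_f)$ be a *good* compact open subgroup, that is, a $\Gamma$-stable compact open subgroup with $H^1(\Gamma,K)=\{1\}$, and let $K^\Gamma=K\cap\mathsf G(\mathbb A_f)$ be its group of $\Gamma$-fixed points. For a group $M$ acting on a set $Z$, let $[M\backslash Z]$ be the action groupoid: its objects are the points of $Z$, and the morphisms $z\to z'$ are the $m\in M$ with $mz=z'$. For a groupoid $\mathcal C$ with an action of $\Gamma$, let $\mathcal C^{h\Gamma}$ be the groupoid of homotopy fixed points: its objects are pairs $(x,(\tau_\gamma)_{\gamma\in\Gamma})$ with $x\in\mathcal C$ and isomorphisms $\tau_\gamma:x\to\gamma(x)$ such that $\tau_{\gamma\gamma'}=\gamma(\tau_{\gamma'})\circ\tau_\gamma$ for all $\gamma,\gamma'\in\Gamma$; its morphisms $(x,\tau)\to(x',\tau')$ are the morphisms $f:x\to x'$ of $\mathcal C$ with $\tau'_\gamma\circ f=\gamma(f)\circ\tau_\gamma$ for all $\gamma\in\Gamma$. Suppose that the restriction map $\text{Ш}^1(\mathbb Q,\mathsf G)\to\text{Ш}^1(\mathsf F,\mathsf G)$ is injective. Then the natural functor $$\big[\mathsf G(\mathbb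 Q)\backslash(\mathsf X\times\mathsf G(\mathbb A_f)/K^\Gamma)\big]\longrightarrow\big[\mathsf H(\mathbb Q)\backslash(\mathsf Y\times\mathsf H(\mathbb A_f)/K)\big]^{h\Gamma},$$ induced by the inclusion $\mathsf G\to\mathsf H$ and sending $(h,gK^\Gamma)$ to the image of $(h,gK)$ with $\tau_\gamma=\mathrm{id}$ for all $\gamma$, is an equivalence of groupoids. -/

import Mathlib

open CategoryTheory TensorProduct NumberField
open scoped NumberField.AdeleRing

noncomputable section

namespace ShimuraFixedPoints

universe u v w

/-! ## Non-abelian cohomology -/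

section Cohomology

variable {Γ : Type u} [Group Γ] [TopologicalSpace Γ] {M : Type v} [Group M]

/-- Continuous `1`-cocycles of the topological group `Γ` with values in the discrete group `M`,
on which `Γ` acts by automorphisms through `α`. (If `Γ` is discrete, for instance a finite Galois
group, continuity is no condition.) -/
def Cocycle (α : Γ →* MulAut M) : Type (max u v) :=
  {c : Γ → M // (∀ γ γ', c (γ * γ') = c γ * α γ (c γ')) ∧ IsLocallyConstant c}

/-- Two cocycles are cohomologous if `c' γ = m * c γ * γ(m)⁻¹` for some `m`. -/
def cohomologous (α : Γ →* MulAut M) : Setoid (Cocycle α) where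
  r c c' := ∃ m : M, ∀ γ, c'.1 γ = m * c.1 γ * (α γ m)⁻¹
  iseqv :=
    { refl := fun c => ⟨1, fun γ => by simp⟩
      symm := by
        rintro c c' ⟨m, hm⟩
        exact ⟨m⁻¹, fun γ => by simp [hm, mul_assoc]⟩
      trans := by
        rintro c c' c'' ⟨m, hm⟩ ⟨n, hn⟩
        exact ⟨n * m, fun γ => by simp [hm, hn, mul_assoc]⟩ }

/-- The pointed set `H¹(Γ, M)`. -/
def H1 (α : Γ →* MulAut M) : Type (max u v) := Quotient (cohomologous α)

/-- The trivial cocycle. -/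
def Cocycle.trivial (α : Γ →* MulAut M) : Cocycle α :=
  ⟨fun _ => 1, fun _ _ => by simp, IsLocallyConstant.const 1⟩

/-- The distinguished element of `H¹(Γ, M)`. -/
instance (α : Γ →* MulAut M) : One (H1 α) := ⟨Quotient.mk _ (Cocycle.trivial α)⟩

/-- Functoriality of `H¹` along a continuous homomorphism `f : Γ' → Γ` and a homomorphism
`φ : M → M'` compatible with the actions. -/
def H1.map {Γ' : Type*} [Group Γ'] [TopologicalSpace Γ'] {M' : Type*} [Group M']
    (α : Γ →* MulAut M) (α' : Γ' →* MulAut M') (f : Γ' →* Γ) (hf : Continuous f) (φ : M →* M')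
    (h : ∀ γ m, φ (α (f γ) m) = α' γ (φ m)) : H1 α → H1 α' :=
  Quotient.map
    (fun c => ⟨fun γ => φ (c.1 (f γ)),
      fun γ γ' => by
        change φ (c.1 (f (γ * γ'))) = φ (c.1 (f γ)) * α' γ (φ (c.1 (f γ')))
        rw [map_mul, c.2.1, map_mul, h], (c.2.2.comp_continuous hf).comp φ⟩)
    (by
      rintro c c' ⟨m, hm⟩
      exact ⟨φ m, fun γ => by simp only [hm, map_mul, map_inv, h]⟩)

end Cohomology

/-! ## Affine group schemes over `ℚ` and their points -/

section Points

variable (A : Type u) [CommRing A] [HopfAlgebra ℚ A]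

/-- The group `G(R)` of `R`-points of the affine group scheme `G = Spec A` over `ℚ`; the group law
is convolution. -/
def Points (R : Type v) [CommRing R] [Algebra ℚ R] : Type (max u v) := WithConv (A →ₐ[ℚ] R)

variable {A} {R : Type v} [CommRing R] [Algebra ℚ R] {S : Type w} [CommRing S] [Algebra ℚ S]

instance : Monoid (Points A R) := inferInstanceAs (Monoid (WithConv (A →ₐ[ℚ] R)))

lemma conv_inv_mul_cancel (g : WithConv (A →ₐ[ℚ] R)) :
    WithConv.toConv (g.ofConv.comp (HopfAlgebra.antipodeAlgHom ℚ A)) * g = 1 := by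
  have h1 : (Algebra.TensorProduct.lmul' ℚ (S := R)).comp
      (Algebra.TensorProduct.map
        (g.ofConv.comp (HopfAlgebra.antipodeAlgHom ℚ A)) g.ofConv) =
      g.ofConv.comp ((Algebra.TensorProduct.lmul' ℚ (S := A)).comp
        (Algebra.TensorProduct.map (HopfAlgebra.antipodeAlgHom ℚ A) (AlgHom.id ℚ A))) := by
    ext <;> simp
  apply WithConv.ofConv_injective
  ext a
  have key := congrArg g.ofConv (HopfAlgebra.mul_antipode_rTensor_comul_apply (R := ℚ) a)
  exact (DFunLike.congr_fun h1 (Coalgebra.comul (R := ℚ) a)).trans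
    (Eq.trans rfl (key.trans (g.ofConv.commutes _)))

instance : Group (Points A R) where
  inv g := WithConv.toConv ((WithConv.ofConv g).comp (HopfAlgebra.antipodeAlgHom ℚ A))
  inv_mul_cancel g := conv_inv_mul_cancel (A := A) (R := R) g

/-- The value of the function `a ∈ A = 𝒪(G)` at the point `g ∈ G(R)`. -/
def Points.eval (g : Points A R) : A →ₐ[ℚ] R := WithConv.ofConv g

/-- Functoriality of `R ↦ G(R)`. A ring homomorphism between `ℚ`-algebras is `ℚ`-linear. -/
def Points.map (f : R →+* S) : Points A R →* Points A S where
  toFun g := WithConv.toConv (f.toRatAlgHom.comp (WithConv.ofConv g))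
  map_one' := by
    apply WithConv.ofConv_injective
    ext a
    exact (f.toRatAlgHom : R →ₐ[ℚ] S).commutes (Coalgebra.counit (R := ℚ) a)
  map_mul' g h := by
    apply WithConv.ofConv_injective
    exact AlgHom.comp_convMul_distrib (f.toRatAlgHom : R →ₐ[ℚ] S) (g : WithConv (A →ₐ[ℚ] R)) h

@[simp] lemma Points.eval_map (f : R →+* S) (g : Points A R) (a : A) :
    (Points.map f g).eval a = f (g.eval a) := rfl

@[ext] lemma Points.ext {g h : Points A R} (H : ∀ a, g.eval a = h.eval a) : g = h :=
  WithConv.ofConv_injective (AlgHom.ext H)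

variable (A R) in
/-- Ring automorphisms of `R` act on `G(R)`. -/
def Points.ringAut : RingAut R →* MulAut (Points A R) where
  toFun σ :=
    { Points.map (A := A) (σ : R →+* R) with
      invFun := Points.map ((σ⁻¹ : RingAut R) : R →+* R)
      left_inv := fun _ => Points.ext fun _ => σ.symm_apply_apply _
      right_inv := fun _ => Points.ext fun _ => σ.apply_symm_apply _ }
  map_one' := rfl
  map_mul' _ _ := rfl

@[simp] lemma Points.eval_ringAut (σ : RingAut R) (g : Points A R) (a : A) :
    (Points.ringAut A R σ g).eval a = σ (g.eval a) := rfl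

/-- For a topological ring `R`, the topology on `G(R)` is the coarsest one for which all
functions in `A = 𝒪(G)` are continuous. -/
instance [TopologicalSpace R] : TopologicalSpace (Points A R) :=
  TopologicalSpace.induced (fun g a => g.eval a) Pi.topologicalSpace

end Points

/-! ## Galois cohomology and the Tate-Shafarevich set -/

section Galois

variable (A : Type u) [CommRing A] [HopfAlgebra ℚ A]

/-- The action of `Gal(k̄/k)` on `G(k̄)`. -/
def galoisAction (k : Type v) [Field k] [Algebra ℚ k] :
    Gal(AlgebraicClosure k/k) →* MulAut (Points A (AlgebraicClosure k)) :=
  (Points.ringAut A (AlgebraicClosure k)).comp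
    (MulSemiringAction.toRingAut Gal(AlgebraicClosure k/k) (AlgebraicClosure k))

/-- `H¹(k, G) = H¹(Gal(k̄/k), G(k̄))`. -/
abbrev GaloisH1 (k : Type v) [Field k] [Algebra ℚ k] : Type (max u v) := H1 (galoisAction A k)

variable (k : Type v) [Field k] (L : Type w) [Field L] [Algebra k L]

/-- A choice of embedding `k̄ → L̄` over `k`. -/
def closureEmb : AlgebraicClosure k →ₐ[k] AlgebraicClosure L := IsAlgClosed.lift

/-- The restriction homomorphism `Gal(L̄/L) → Gal(k̄/k)` along the embedding `k̄ → L̄`. -/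
def galoisRes : Gal(AlgebraicClosure L/L) →* Gal(AlgebraicClosure k/k) :=
  letI : Algebra (AlgebraicClosure k) (AlgebraicClosure L) := (closureEmb k L).toRingHom.toAlgebra
  haveI : IsScalarTower k (AlgebraicClosure k) (AlgebraicClosure L) :=
    IsScalarTower.of_algebraMap_eq fun x => ((closureEmb k L).commutes x).symm
  (AlgEquiv.restrictNormalHom (F := k) (K₁ := AlgebraicClosure L) (AlgebraicClosure k)).comp
    (AlgEquiv.restrictScalarsHom k)

lemma closureEmb_galoisRes (σ : Gal(AlgebraicClosure L/L)) (x : AlgebraicClosure k) :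
    closureEmb k L (galoisRes k L σ x) = σ (closureEmb k L x) := by
  let _ : Algebra (AlgebraicClosure k) (AlgebraicClosure L) := (closureEmb k L).toRingHom.toAlgebra
  have _ : IsScalarTower k (AlgebraicClosure k) (AlgebraicClosure L) :=
    IsScalarTower.of_algebraMap_eq fun x => ((closureEmb k L).commutes x).symm
  exact AlgEquiv.restrictNormal_commutes (F := k) (K₁ := AlgebraicClosure L)
    (K₂ := AlgebraicClosure L) (σ.restrictScalars k) (AlgebraicClosure k) x

lemma continuous_galoisRes : Continuous (galoisRes k L) := by
  refine continuous_of_continuousAt_one _ ?_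
  rw [ContinuousAt, map_one]
  intro U hU
  obtain ⟨E, hE, hEU⟩ := (krullTopology_mem_nhds_one_iff _ _ _).1 hU
  obtain ⟨s, hs⟩ := IntermediateField.essFiniteType_iff.1 (inferInstance : Algebra.EssFiniteType k E)
  have key : (⋂ x ∈ s, (MulAction.stabilizer Gal(AlgebraicClosure L/L) (closureEmb k L x) :
      Set Gal(AlgebraicClosure L/L))) ∈ nhds 1 := by
    refine (Filter.biInter_finset_mem s).2 fun x _ => ?_
    exact (stabilizer_isOpen_of_isIntegral (K := L) (closureEmb k L x)).mem_nhds
      (Subgroup.one_mem _)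
  refine Filter.mem_map.2 (Filter.mem_of_superset key fun σ hσ => hEU ?_)
  simp only [Set.mem_iInter, SetLike.mem_coe, MulAction.mem_stabilizer_iff] at hσ
  have hle : E ≤ IntermediateField.fixedField (Subgroup.zpowers (galoisRes k L σ)) := by
    rw [← hs, IntermediateField.adjoin_le_iff]
    intro x hx
    have hx' : galoisRes k L σ • x = x := by
      apply (closureEmb k L).injective
      exact (closureEmb_galoisRes k L σ x).trans (hσ x hx)
    have : galoisRes k L σ ∈ MulAction.stabilizer Gal(AlgebraicClosure k/k) x := hx'
    intro g
    exact (Subgroup.zpowers_le.2 this) g.2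
  exact (IntermediateField.le_iff_le _ _).1 hle (Subgroup.mem_zpowers _)

/-- The base change map `H¹(k, G) → H¹(L, G)` for a field extension `L/k`. It does not depend on
the embedding of algebraic closures. -/
def GaloisH1.baseChange [Algebra ℚ k] [Algebra ℚ L] : GaloisH1 A k → GaloisH1 A L :=
  H1.map _ _ (galoisRes k L) (continuous_galoisRes k L)
    (Points.map (closureEmb k L : AlgebraicClosure k →+* AlgebraicClosure L))
    (fun γ m => Points.ext fun a => closureEmb_galoisRes k L γ (m.eval a))

/-- `Ш¹(k, G)` for a number field `k`: the classes in `H¹(k, G)` that become trivial in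
`H¹(k_v, G)` for all finite and infinite places `v` of `k`. For an extension `L/k` of number fields,
the map `Ш¹(k, G) → Ш¹(L, G)` is the restriction of `H¹(k, G) → H¹(L, G)`; since
`Ш¹(L, G) ⊆ H¹(L, G)`, it is injective if and only if `GaloisH1.baseChange A k L` is injective on
`Sha1 A k`. -/
def Sha1 (k : Type v) [Field k] [NumberField k] : Set (GaloisH1 A k) :=
  {x | (∀ v : IsDedekindDomain.HeightOneSpectrum (𝓞 k),
          GaloisH1.baseChange A k (v.adicCompletion k) x = 1) ∧
       (∀ v : InfinitePlace k, GaloisH1.baseChange A k v.Completion x = 1)}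

end Galois

/-! ## Connected reductive groups -/

section Reductive

variable (A : Type u) [CommRing A] [HopfAlgebra ℚ A]

/-- The coordinate ring of the variety `G(Ω)`, as a ring of functions: the `Ω`-algebra generated
by the functions `x ↦ x(a)`, `a ∈ A`. -/
def regularFunctions (Ω : Type v) [Field Ω] [Algebra ℚ Ω] : Subalgebra Ω (Points A Ω → Ω) :=
  Algebra.adjoin Ω (Set.range fun (a : A) (x : Points A Ω) => x.eval a)

/-- The Zariski topology on `G(Ω)`. -/
@[reducible] def zariskiTopology (Ω : Type v) [Field Ω] [Algebra ℚ Ω] : TopologicalSpace (Points A Ω) :=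
  TopologicalSpace.generateFrom {U | ∃ f ∈ regularFunctions A Ω, U = {x | f x ≠ 0}}

variable {A}

/-- `g ∈ G(Ω)` is unipotent: right translation by `g` is a locally unipotent operator on the
coordinate ring, that is, every regular function is killed by a power of `ρ_g - 1`. -/
def IsUnipotent {Ω : Type v} [Field Ω] [Algebra ℚ Ω] (g : Points A Ω) : Prop :=
  ∀ f ∈ regularFunctions A Ω, ∃ n : ℕ,
    (fun (φ : Points A Ω → Ω) (x : Points A Ω) => φ (x * g) - φ x)^[n] f = 0

variable (A)

/-- `G = Spec A` is a connected reductive group over `ℚ`: it is of finite type and connected, and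
`G(Ω)`, for `Ω` an algebraic closure of `ℚ`, has no nontrivial closed connected normal unipotent
subgroup. (Group schemes of finite type over a field of characteristic zero are smooth.) -/
structure IsConnectedReductive : Prop where
  finiteType : Algebra.FiniteType ℚ A
  connected : ConnectedSpace (PrimeSpectrum A)
  unipotentRadical : ∀ N : Subgroup (Points A (AlgebraicClosure ℚ)), N.Normal →
    @IsClosed _ (zariskiTopology A (AlgebraicClosure ℚ)) N →
    @IsConnected _ (zariskiTopology A (AlgebraicClosure ℚ)) N →
    (∀ g ∈ N, IsUnipotent g) → N = ⊥

end Reductive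

/-! ## Shimura data -/

section ShimuraDatum

/-- Conjugation of a homomorphism `h : N → M` by an element `m ∈ M`. -/
def conjHom {N M : Type*} [Group N] [Group M] (m : M) (h : N →* M) : N →* M :=
  (MulAut.conj m).toMonoidHom.comp h

@[simp] lemma conjHom_apply {N M : Type*} [Group N] [Group M] (m : M) (h : N →* M) (z : N) :
    conjHom m h z = m * h z * m⁻¹ := rfl

variable {A : Type u} [CommRing A] [HopfAlgebra ℚ A]

/-- A homomorphism `𝕊 → G_ℝ` of algebraic groups over `ℝ`, where `𝕊 = Res_{ℂ/ℝ} 𝔾ₘ` is the Deligne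
torus with coordinate ring `ℝ[x, y, (x² + y²)⁻¹]`, is given by a homomorphism
`𝕊(ℝ) = ℂˣ → G(ℝ)` along which all functions on `G` pull back to regular functions on `𝕊`
(`𝕊(ℝ)` is Zariski dense in `𝕊`). -/
def IsAlgebraicHom (h : ℂˣ →* Points A ℝ) : Prop :=
  ∀ a : A, ∃ (p : MvPolynomial (Fin 2) ℝ) (n : ℕ), ∀ z : ℂˣ,
    (h z).eval a = MvPolynomial.eval ![(z : ℂ).re, (z : ℂ).im] p / Complex.normSq (z : ℂ) ^ n

/-- The map `G(ℝ) → G(ℂ)`. -/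
def toComplex : Points A ℝ →* Points A ℂ := Points.map (algebraMap ℝ ℂ)

/-- Complex conjugation on `G(ℂ)`. -/
def complexConj : Points A ℂ →* Points A ℂ := Points.map (starRingEnd ℂ)

/-- Elements of `Lie(G)_ℂ`: derivations `A → ℂ` at the identity element of `G`. -/
def IsLie (D : A →ₗ[ℚ] ℂ) : Prop :=
  ∀ a b : A, D (a * b) = (Coalgebra.counit (R := ℚ) a : ℂ) * D b + (Coalgebra.counit (R := ℚ) b : ℂ) * D a

/-- The adjoint action `Ad(g) D = g * D * g⁻¹` of `G(ℂ)` on `Lie(G)_ℂ`, with products taken in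
the convolution algebra of linear maps `A → ℂ`. -/
def adjointAction (g : Points A ℂ) (D : A →ₗ[ℚ] ℂ) : A →ₗ[ℚ] ℂ :=
  (WithConv.toConv g.eval.toLinearMap * WithConv.toConv D *
    WithConv.toConv (g⁻¹).eval.toLinearMap).ofConv

/-- (SV1) Only the characters `z / z̄`, `1`, `z̄ / z` of `𝕊` occur in `Lie(G)_ℂ` with the action
`Ad ∘ h`. -/
def SV1 (h : ℂˣ →* Points A ℝ) : Prop :=
  ∀ D : A →ₗ[ℚ] ℂ, IsLie D → ∃ D₁ D₂ D₃ : A →ₗ[ℚ] ℂ,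
    IsLie D₁ ∧ IsLie D₂ ∧ IsLie D₃ ∧ D = D₁ + D₂ + D₃ ∧
    ∀ z : ℂˣ,
      adjointAction (toComplex (h z)) D₁ = ((z : ℂ) / starRingEnd ℂ z) • D₁ ∧
      adjointAction (toComplex (h z)) D₂ = D₂ ∧
      adjointAction (toComplex (h z)) D₃ = (starRingEnd ℂ z / (z : ℂ)) • D₃

/-- The imaginary unit as an element of `𝕊(ℝ) = ℂˣ`. -/
def unitI : ℂˣ := Units.mk0 Complex.I Complex.I_ne_zero

/-- (SV2) `θ = ad(h(i))` is a Cartan involution of `G^ad_ℝ`: it is an involution of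
`G^ad(ℂ) = G(ℂ) / Z(ℂ)`, and the real form `{g ∈ G^ad(ℂ) | g = θ(ḡ)}` is compact. -/
def SV2 (h : ℂˣ →* Points A ℝ) : Prop :=
  toComplex (h unitI) ^ 2 ∈ Subgroup.center (Points A ℂ) ∧
  IsCompact ((QuotientGroup.mk : Points A ℂ → Points A ℂ ⧸ Subgroup.center (Points A ℂ)) ''
    {g | g⁻¹ * (toComplex (h unitI) * complexConj g * (toComplex (h unitI))⁻¹) ∈
      Subgroup.center (Points A ℂ)})

/-- (SV3) `G^ad` has no nontrivial `ℚ`-factor on which the projection of `h` is trivial. The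
quotient groups of `G` over `ℚ` are the spectra of the Hopf subalgebras `B` of `A`; such a quotient
is a factor of `G^ad` exactly if the centre of `G` maps trivially to it. -/
def SV3 (h : ℂˣ →* Points A ℝ) : Prop :=
  ∀ B : Subalgebra ℚ A,
    (∀ b ∈ B, Coalgebra.comul (R := ℚ) b ∈
      LinearMap.range (TensorProduct.map B.val.toLinearMap B.val.toLinearMap)) →
    (∀ b ∈ B, HopfAlgebra.antipode ℚ b ∈ B) →
    (∀ z ∈ Subgroup.center (Points A ℂ), ∀ b ∈ B, z.eval b = (Coalgebra.counit (R := ℚ) b : ℂ)) →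
    (∀ z : ℂˣ, ∀ b ∈ B, (h z).eval b = (Coalgebra.counit (R := ℚ) b : ℝ)) →
    B = ⊥

variable (A) in
/-- `(G, X)` is a Shimura datum, where `G = Spec A`: `G` is a connected reductive group over `ℚ`
and `X` is a `G(ℝ)`-conjugacy class of homomorphisms `𝕊 → G_ℝ` satisfying Deligne's axioms. -/
structure IsShimuraDatum (X : Set (ℂˣ →* Points A ℝ)) : Prop where
  reductive : IsConnectedReductive A
  conjClass : ∃ h₀, X = Set.range fun g : Points A ℝ => conjHom g h₀
  algebraic : ∀ h ∈ X, IsAlgebraicHom h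
  sv1 : ∀ h ∈ X, SV1 h
  sv2 : ∀ h ∈ X, SV2 h
  sv3 : ∀ h ∈ X, SV3 h

end ShimuraDatum

/-! ## Action groupoids and homotopy fixed points -/

section Groupoids

/-- The action groupoid (quotient stack over a point) `[G \ X]` of an action `ρ` of `G` on `X`. -/
structure ActionGroupoid {G : Type u} {X : Type v} [Group G] (ρ : G →* Equiv.Perm X) where
  pt : X

variable {G : Type u} {X : Type v} [Group G] {ρ : G →* Equiv.Perm X}

/-- A morphism `x → y` is an element `g ∈ G` with `g x = y`. -/
@[ext] structure ActionGroupoid.Hom (x y : ActionGroupoid ρ) where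
  val : G
  map_pt : ρ val x.pt = y.pt

/-- Composition of morphisms is multiplication in `G`. -/
instance : Groupoid (ActionGroupoid ρ) where
  Hom x y := ActionGroupoid.Hom x y
  id x := ⟨1, by simp⟩
  comp f g := ⟨g.val * f.val, by rw [map_mul, Equiv.Perm.mul_apply, f.map_pt, g.map_pt]⟩
  inv f := ⟨f.val⁻¹, by rw [map_inv, Equiv.Perm.inv_eq_iff_eq, f.map_pt]⟩
  id_comp f := ActionGroupoid.Hom.ext (mul_one f.val)
  comp_id f := ActionGroupoid.Hom.ext (one_mul f.val)
  assoc f g h := ActionGroupoid.Hom.ext (mul_assoc h.val g.val f.val).symm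
  inv_comp f := ActionGroupoid.Hom.ext (mul_inv_cancel f.val)
  comp_inv f := ActionGroupoid.Hom.ext (inv_mul_cancel f.val)

/-- The element of `G` underlying a morphism of the action groupoid. -/
def ActionGroupoid.val {x y : ActionGroupoid ρ} (f : x ⟶ y) : G := ActionGroupoid.Hom.val f

lemma ActionGroupoid.hom_ext {x y : ActionGroupoid ρ} {f g : x ⟶ y} (h : val f = val g) : f = g :=
  ActionGroupoid.Hom.ext h

lemma ActionGroupoid.val_map_pt {x y : ActionGroupoid ρ} (f : x ⟶ y) : ρ (val f) x.pt = y.pt :=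
  ActionGroupoid.Hom.map_pt f

@[simp] lemma ActionGroupoid.val_id (x : ActionGroupoid ρ) : val (𝟙 x) = 1 := rfl

@[simp] lemma ActionGroupoid.val_comp {x y z : ActionGroupoid ρ} (f : x ⟶ y) (g : y ⟶ z) :
    val (f ≫ g) = val g * val f := rfl

@[simp] lemma ActionGroupoid.val_eqToHom {x y : ActionGroupoid ρ} (h : x = y) :
    val (eqToHom h) = 1 := by
  subst h; rfl

/-- The isomorphism between equal objects given by the element `1 ∈ G`. -/
def ActionGroupoid.isoOfEq {x y : ActionGroupoid ρ} (h : x.pt = y.pt) : x ≅ y where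
  hom := ⟨1, by simpa using h⟩
  inv := ⟨1, by simpa using h.symm⟩
  hom_inv_id := ActionGroupoid.Hom.ext (mul_one 1)
  inv_hom_id := ActionGroupoid.Hom.ext (mul_one 1)

@[simp] lemma ActionGroupoid.val_isoOfEq_hom {x y : ActionGroupoid ρ} (h : x.pt = y.pt) :
    val (isoOfEq h).hom = 1 := rfl

/-- Functoriality of action groupoids in pairs of a group homomorphism `i` and an `i`-equivariant
map `f`. -/
def ActionGroupoid.map {H : Type*} {Y : Type*} [Group H] {ρ' : H →* Equiv.Perm Y} (i : G →* H)
    (f : X → Y) (hf : ∀ g x, f (ρ g x) = ρ' (i g) (f x)) :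
    ActionGroupoid ρ ⥤ ActionGroupoid ρ' where
  obj x := ⟨f x.pt⟩
  map {x y} φ := ⟨i (val φ), by rw [← hf, val_map_pt φ]⟩
  map_id _ := hom_ext (map_one i)
  map_comp φ ψ := hom_ext (map_mul i (val ψ) (val φ))

section

variable {H : Type*} {Y : Type*} [Group H] {ρ' : H →* Equiv.Perm Y} (i : G →* H)
    (f : X → Y) (hf : ∀ g x, f (ρ g x) = ρ' (i g) (f x))

@[simp] lemma ActionGroupoid.map_obj_pt (x : ActionGroupoid ρ) :
    ((ActionGroupoid.map i f hf).obj x).pt = f x.pt := rfl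

@[simp] lemma ActionGroupoid.val_map {x y : ActionGroupoid ρ} (φ : x ⟶ y) :
    val ((ActionGroupoid.map i f hf).map φ) = i (val φ) := rfl

end

/-- A weak action of the group `Γ` on the category `C`, that is, a weak functor from the
one-object category `BΓ` to the strict `(2,1)`-category of categories. -/
structure WeakAction (Γ : Type*) [Group Γ] (C : Type*) [Category C] where
  act : Γ → C ⥤ C
  oneIso : 𝟭 C ≅ act 1
  mulIso : ∀ a b : Γ, act (a * b) ≅ act b ⋙ act a
  one_mul : ∀ (a : Γ) (x : C), (mulIso 1 a).hom.app x =
    eqToHom (by simp) ≫ oneIso.hom.app ((act a).obj x)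
  mul_one : ∀ (a : Γ) (x : C), (mulIso a 1).hom.app x =
    eqToHom (by simp) ≫ (act a).map (oneIso.hom.app x)
  mul_assoc : ∀ (a b c : Γ) (x : C),
    (mulIso (a * b) c).hom.app x ≫ (mulIso a b).hom.app ((act c).obj x) =
      eqToHom (by simp [_root_.mul_assoc]) ≫ (mulIso a (b * c)).hom.app x ≫
        (act a).map ((mulIso b c).hom.app x)

/-- An object of the category `C^{hΓ}` of homotopy fixed points: an object `x` of `C` with
isomorphisms `τ_γ : x ≅ γ(x)` satisfying the cocycle condition. -/
structure HomotopyFixedPoints {Γ : Type*} [Group Γ] {C : Type*} [Category C]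
    (W : WeakAction Γ C) where
  pt : C
  τ : ∀ γ : Γ, pt ≅ (W.act γ).obj pt
  cocycle : ∀ a b : Γ, (τ (a * b)).hom ≫ (W.mulIso a b).hom.app pt =
    (τ a).hom ≫ (W.act a).map (τ b).hom

/-- A morphism of homotopy fixed points is a morphism of the underlying objects commuting with
the `τ_γ`. -/
instance {Γ : Type*} [Group Γ] {C : Type*} [Category C] (W : WeakAction Γ C) :
    Category (HomotopyFixedPoints W) where
  Hom x y := {f : x.pt ⟶ y.pt // ∀ γ, f ≫ (y.τ γ).hom = (x.τ γ).hom ≫ (W.act γ).map f}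
  id x := ⟨𝟙 x.pt, fun γ => by simp⟩
  comp f g := ⟨f.1 ≫ g.1, fun γ => by
    rw [Category.assoc, g.2, ← Category.assoc, f.2, Category.assoc, Functor.map_comp]⟩
  id_comp f := Subtype.ext (Category.id_comp f.1)
  comp_id f := Subtype.ext (Category.comp_id f.1)
  assoc f g h := Subtype.ext (Category.assoc f.1 g.1 h.1)

section

variable {Γ : Type*} [Group Γ] (α : Γ →* MulAut G) (β : Γ →* Equiv.Perm X)
    (h : ∀ γ g x, β γ (ρ g x) = ρ (α γ g) (β γ x))

/-- The functor `[G \ X] → [G \ X]` given by an element `γ` of a group `Γ` acting through `α` on `G`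
and through `β` on `X`, such that the action of `G` on `X` is `Γ`-semilinear. -/
def ActionGroupoid.actFunctor (γ : Γ) : ActionGroupoid ρ ⥤ ActionGroupoid ρ :=
  ActionGroupoid.map (α γ).toMonoidHom (β γ) (h γ)

@[simp] lemma ActionGroupoid.actFunctor_obj_pt (γ : Γ) (x : ActionGroupoid ρ) :
    ((actFunctor α β h γ).obj x).pt = β γ x.pt := rfl

@[simp] lemma ActionGroupoid.val_actFunctor_map (γ : Γ) {x y : ActionGroupoid ρ} (f : x ⟶ y) :
    val ((actFunctor α β h γ).map f) = α γ (val f) := rfl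

/-- The induced action of `Γ` on the action groupoid `[G \ X]`. -/
def ActionGroupoid.weakAction : WeakAction Γ (ActionGroupoid ρ) where
  act γ := actFunctor α β h γ
  oneIso := NatIso.ofComponents (fun x => isoOfEq (by simp)) (fun f => hom_ext (by simp))
  mulIso a b := NatIso.ofComponents (fun x => isoOfEq (by simp)) (fun f => hom_ext (by
    change 1 * α (a * b) (val f) = α a (α b (val f)) * 1
    simp))
  one_mul a x := hom_ext (by
    rw [val_comp, val_eqToHom, _root_.mul_one]
    rfl)
  mul_one a x := hom_ext (by
    rw [val_comp, val_eqToHom]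
    change (1 : G) = α a 1 * 1
    rw [map_one, _root_.mul_one])
  mul_assoc a b c x := hom_ext (by
    rw [val_comp, val_comp, val_comp, val_eqToHom, _root_.mul_one]
    change (1 : G) * 1 = α a 1 * 1
    rw [map_one])

end

/-- The natural functor `[G \ X] → [H \ Y]^{hΓ}` induced by a group homomorphism `i : G → H` and an
`i`-equivariant map `f : X → Y` whose images are fixed by `Γ`: it sends `x` to `f(x)` with the
identity isomorphisms `f(x) = γ(f(x))`. -/
def ActionGroupoid.toHomotopyFixedPoints {Γ : Type*} [Group Γ] {H : Type*} {Y : Type*} [Group H]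
    {ρ' : H →* Equiv.Perm Y} (α : Γ →* MulAut H) (β : Γ →* Equiv.Perm Y)
    (h : ∀ γ g y, β γ (ρ' g y) = ρ' (α γ g) (β γ y))
    (i : G →* H) (f : X → Y) (hf : ∀ g x, f (ρ g x) = ρ' (i g) (f x))
    (hi : ∀ γ g, α γ (i g) = i g) (hfix : ∀ γ x, β γ (f x) = f x) :
    ActionGroupoid ρ ⥤ HomotopyFixedPoints (ActionGroupoid.weakAction α β h) where
  obj x :=
    { pt := ⟨f x.pt⟩
      τ := fun γ => isoOfEq (hfix γ x.pt).symm
      cocycle := fun a b => hom_ext (by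
        change (1 : H) * 1 = α a 1 * 1
        rw [map_one]) }
  map φ := ⟨(ActionGroupoid.map i f hf).map φ, fun γ => hom_ext (by
    change 1 * i (val φ) = α γ (i (val φ)) * 1
    rw [hi, one_mul, mul_one])⟩
  map_id x := Subtype.ext ((ActionGroupoid.map i f hf).map_id x)
  map_comp φ ψ := Subtype.ext ((ActionGroupoid.map i f hf).map_comp φ ψ)

end Groupoids

/-! ## The spaces `X × P/K` -/

section Level

/-- A group homomorphism `G → Perm X` from an action of `G` on `X` by functions. -/
def permHom {G X : Type*} [Group G] (act : G → X → X) (h1 : ∀ x, act 1 x = x)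
    (hm : ∀ g g' x, act (g * g') x = act g (act g' x)) : G →* Equiv.Perm X where
  toFun g :=
    { toFun := act g
      invFun := act g⁻¹
      left_inv := fun x => by rw [← hm, inv_mul_cancel, h1]
      right_inv := fun x => by rw [← hm, mul_inv_cancel, h1] }
  map_one' := Equiv.ext h1
  map_mul' g g' := Equiv.ext (hm g g')

variable {N Q R P Q' R' P' Γ : Type*} [Group N] [Group Q] [Group R] [Group P] [Group Q'] [Group R']
  [Group P'] [Group Γ]

/-- The set `X × P/K`, for a set `X` of homomorphisms `N → R` and a subgroup `K` of a group `P`. -/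
abbrev LevelSpace (X : Set (N →* R)) (K : Subgroup P) := X × (P ⧸ K)

lemma levelSpace_ext {X : Set (N →* R)} {K : Subgroup P} {x y : LevelSpace X K}
    (h1 : ∀ z, x.1.1 z = y.1.1 z) (h2 : x.2 = y.2) : x = y :=
  Prod.ext (Subtype.ext (MonoidHom.ext h1)) h2

/-- The action of a group `Q` on `X × P/K`, by conjugation through `i : Q → R` on `X` and by left
translation through `j : Q → P` on `P/K`. -/
def levelAction (i : Q →* R) (j : Q →* P) (X : Set (N →* R))
    (hX : ∀ r : R, ∀ x ∈ X, conjHom r x ∈ X) (K : Subgroup P) :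
    Q →* Equiv.Perm (LevelSpace X K) :=
  permHom (fun q x => (⟨conjHom (i q) x.1.1, hX _ _ x.1.2⟩, j q • x.2))
    (fun x => levelSpace_ext (fun z => by simp) (by simp))
    (fun q q' x => levelSpace_ext (fun z => by simp [mul_assoc]) (by simp [mul_smul]))

/-- The action of a group `Γ` on `X × P/K` induced by its actions `αR` on `R` and `αP` on `P` which
preserve `X` and `K`. -/
def levelGal (αR : Γ →* MulAut R) (αP : Γ →* MulAut P) (X : Set (N →* R))
    (hX : ∀ γ, ∀ x ∈ X, (αR γ).toMonoidHom.comp x ∈ X) (K : Subgroup P)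
    (hK : ∀ γ, ∀ k ∈ K, αP γ k ∈ K) : Γ →* Equiv.Perm (LevelSpace X K) :=
  permHom
    (fun γ x => (⟨(αR γ).toMonoidHom.comp x.1.1, hX γ _ x.1.2⟩,
      Quotient.map' (αP γ) (fun a b hab => by
        rw [QuotientGroup.leftRel_apply] at hab ⊢
        rw [← map_inv, ← map_mul]
        exact hK γ _ hab) x.2))
    (fun x => levelSpace_ext (fun z => by simp) (by
      obtain ⟨y, c⟩ := x
      induction c using QuotientGroup.induction_on with
      | H c => simp [Quotient.map'_mk'']))
    (fun γ γ' x => levelSpace_ext (fun z => by simp) (by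
      obtain ⟨y, c⟩ := x
      induction c using QuotientGroup.induction_on with
      | H c => simp [Quotient.map'_mk'']))

lemma levelGal_levelAction (αR : Γ →* MulAut R) (αP : Γ →* MulAut P) (X : Set (N →* R))
    (hX : ∀ γ, ∀ x ∈ X, (αR γ).toMonoidHom.comp x ∈ X) (K : Subgroup P)
    (hK : ∀ γ, ∀ k ∈ K, αP γ k ∈ K) (i : Q →* R) (j : Q →* P)
    (hX' : ∀ r : R, ∀ x ∈ X, conjHom r x ∈ X) (αQ : Γ →* MulAut Q)
    (hi : ∀ γ q, αR γ (i q) = i (αQ γ q)) (hj : ∀ γ q, αP γ (j q) = j (αQ γ q))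
    (γ : Γ) (q : Q) (x : LevelSpace X K) :
    levelGal αR αP X hX K hK γ (levelAction i j X hX' K q x) =
      levelAction i j X hX' K (αQ γ q) (levelGal αR αP X hX K hK γ x) := by
  obtain ⟨y, c⟩ := x
  induction c using QuotientGroup.induction_on with
  | H c =>
  refine levelSpace_ext (fun z => ?_) ?_
  · change αR γ (i q * y.1 z * (i q)⁻¹) = i (αQ γ q) * αR γ (y.1 z) * (i (αQ γ q))⁻¹
    rw [map_mul, map_mul, map_inv, hi]
  · change ((αP γ (j q * c) : P) : P ⧸ K) = ((j (αQ γ q) * αP γ c : P) : P ⧸ K)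
    rw [map_mul, hj]

/-- The map `X × P/(K ∩ P) → Y × P'/K` induced by homomorphisms `a : R → R'` and `b : P → P'`. -/
def levelMap (a : R →* R') (b : P →* P') (X : Set (N →* R)) (Y : Set (N →* R'))
    (h : ∀ x ∈ X, a.comp x ∈ Y) (K : Subgroup P') (x : LevelSpace X (K.comap b)) :
    LevelSpace Y K :=
  (⟨a.comp x.1.1, h _ x.1.2⟩,
    Quotient.map' b (fun c d hcd => by
      rw [QuotientGroup.leftRel_apply] at hcd ⊢
      rw [← map_inv, ← map_mul]
      exact hcd) x.2)

lemma levelMap_levelAction (a : R →* R') (b : P →* P') (X : Set (N →* R)) (Y : Set (N →* R'))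
    (h : ∀ x ∈ X, a.comp x ∈ Y) (K : Subgroup P') (i : Q →* R) (j : Q →* P) (i' : Q' →* R')
    (j' : Q' →* P') (hX : ∀ r : R, ∀ x ∈ X, conjHom r x ∈ X)
    (hY : ∀ r : R', ∀ x ∈ Y, conjHom r x ∈ Y) (q : Q →* Q') (hi : ∀ g, a (i g) = i' (q g))
    (hj : ∀ g, b (j g) = j' (q g)) (g : Q) (x : LevelSpace X (K.comap b)) :
    levelMap a b X Y h K (levelAction i j X hX (K.comap b) g x) =
      levelAction i' j' Y hY K (q g) (levelMap a b X Y h K x) := by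
  obtain ⟨y, c⟩ := x
  induction c using QuotientGroup.induction_on with
  | H c =>
  refine levelSpace_ext (fun z => ?_) ?_
  · change a (i g * y.1 z * (i g)⁻¹) = i' (q g) * a (y.1 z) * (i' (q g))⁻¹
    rw [map_mul, map_mul, map_inv, hi]
  · change ((b (j g * c) : P') : P' ⧸ K) = ((j' (q g) * b c : P') : P' ⧸ K)
    rw [map_mul, hj]

lemma levelGal_levelMap (a : R →* R') (b : P →* P') (X : Set (N →* R)) (Y : Set (N →* R'))
    (h : ∀ x ∈ X, a.comp x ∈ Y) (K : Subgroup P') (αR : Γ →* MulAut R') (αP : Γ →* MulAut P')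
    (hY : ∀ γ, ∀ x ∈ Y, (αR γ).toMonoidHom.comp x ∈ Y)
    (hK : ∀ γ, ∀ k ∈ K, αP γ k ∈ K) (ha : ∀ γ r, αR γ (a r) = a r) (hb : ∀ γ r, αP γ (b r) = b r)
    (γ : Γ) (x : LevelSpace X (K.comap b)) :
    levelGal αR αP Y hY K hK γ (levelMap a b X Y h K x) = levelMap a b X Y h K x := by
  obtain ⟨y, c⟩ := x
  induction c using QuotientGroup.induction_on with
  | H c =>
  refine levelSpace_ext (fun z => ha γ _) ?_
  exact congrArg (QuotientGroup.mk : P' → P' ⧸ K) (hb γ c)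

/-- The action of `Γ` on a `Γ`-stable subgroup. -/
def restrictAction (α : Γ →* MulAut P) (K : Subgroup P) (hK : ∀ γ, ∀ k ∈ K, α γ k ∈ K) :
    Γ →* MulAut K where
  toFun γ :=
    { toFun := fun k => ⟨α γ k, hK γ k k.2⟩
      invFun := fun k => ⟨α γ⁻¹ k, hK γ⁻¹ k k.2⟩
      left_inv := fun k => Subtype.ext (by simp)
      right_inv := fun k => Subtype.ext (by simp)
      map_mul' := fun k k' => Subtype.ext (map_mul _ _ _) }
  map_one' := by ext k; simp
  map_mul' γ γ' := by ext k; simp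

end Level

/-! ## Shimura groupoids -/

section Adelic

/-- The ring `𝔸_f` of finite adeles of `ℚ`. -/
abbrev Af : Type := 𝔸ᶠ[ℚ]

variable (A : Type u) [CommRing A] [HopfAlgebra ℚ A] (F : Type v) [Field F] [NumberField F]

/-- The group `H(R) = G(R ⊗_ℚ F)` of `R`-points of `H = Res_{F/ℚ} G_F`. -/
abbrev ResPoints (R : Type w) [CommRing R] [Algebra ℚ R] : Type (max u v w) := Points A (R ⊗[ℚ] F)

variable {A} {R : Type w} [CommRing R] [Algebra ℚ R]

/-- Functoriality of `R ↦ H(R)`. -/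
def ResPoints.map {S : Type*} [CommRing S] [Algebra ℚ S] (f : R →+* S) :
    ResPoints A F R →* ResPoints A F S :=
  Points.map (Algebra.TensorProduct.map f.toRatAlgHom (AlgHom.id ℚ F) : R ⊗[ℚ] F →+* S ⊗[ℚ] F)

/-- The embedding `G(R) → H(R)`. -/
def toRes : Points A R →* ResPoints A F R :=
  Points.map (Algebra.TensorProduct.includeLeft : R →ₐ[ℚ] R ⊗[ℚ] F).toRingHom

variable (R) in
/-- The action of `Γ = Gal(F/ℚ)` on `R ⊗ F` through the second factor. -/
def galRingAut : Gal(F/ℚ) →* RingAut (R ⊗[ℚ] F) where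
  toFun γ := (Algebra.TensorProduct.congr (AlgEquiv.refl : R ≃ₐ[ℚ] R) γ).toRingEquiv
  map_one' := by
    ext x
    induction x with
    | zero => simp
    | add x y hx hy => simp only [map_add, hx, hy]
    | tmul r f => rfl
  map_mul' γ γ' := by
    ext x
    induction x with
    | zero => simp
    | add x y hx hy => simp only [map_add, hx, hy]
    | tmul r f => rfl

variable (A R) in
/-- The action of `Γ = Gal(F/ℚ)` on `H(R)`. -/
def gal : Gal(F/ℚ) →* MulAut (ResPoints A F R) :=
  (Points.ringAut A (R ⊗[ℚ] F)).comp (galRingAut F R)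

lemma gal_toRes (γ : Gal(F/ℚ)) (g : Points A R) : gal A F R γ (toRes F g) = toRes F g := by
  ext a
  change (g.eval a) ⊗ₜ[ℚ] γ (1 : F) = (g.eval a) ⊗ₜ[ℚ] (1 : F)
  rw [map_one]

lemma toRes_map {S : Type*} [CommRing S] [Algebra ℚ S] (f : R →+* S) (g : Points A R) :
    toRes F (Points.map f g) = ResPoints.map F f (toRes F g) := by
  ext a
  change f (g.eval a) ⊗ₜ[ℚ] (1 : F) = f (g.eval a) ⊗ₜ[ℚ] (AlgHom.id ℚ F (1 : F))
  rfl

lemma gal_map {S : Type*} [CommRing S] [Algebra ℚ S] (f : R →+* S) (γ : Gal(F/ℚ))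
    (g : ResPoints A F R) :
    gal A F S γ (ResPoints.map F f g) = ResPoints.map F f (gal A F R γ g) := by
  ext a
  change galRingAut F S γ (Algebra.TensorProduct.map f.toRatAlgHom (AlgHom.id ℚ F) (g.eval a)) =
    Algebra.TensorProduct.map f.toRatAlgHom (AlgHom.id ℚ F) (galRingAut F R γ (g.eval a))
  induction g.eval a with
  | zero => simp
  | add x y hx hy => simp only [map_add, hx, hy]
  | tmul r f => rfl

/-- The Piatetski-Shapiro construction `Y`: the `H(ℝ)`-conjugacy class of the composites
`𝕊 → G_ℝ → H_ℝ` for `h ∈ X`. -/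
def resDatum (X : Set (ℂˣ →* Points A ℝ)) : Set (ℂˣ →* ResPoints A F ℝ) :=
  {y | ∃ h ∈ X, ∃ g : ResPoints A F ℝ, y = conjHom g ((toRes F).comp h)}

lemma conj_mem_resDatum (X : Set (ℂˣ →* Points A ℝ)) (g : ResPoints A F ℝ) :
    ∀ y ∈ resDatum F X, conjHom g y ∈ resDatum F X := by
  rintro _ ⟨h, hh, g', rfl⟩
  exact ⟨h, hh, g * g', MonoidHom.ext fun z => by simp [mul_assoc]⟩

lemma gal_mem_resDatum (X : Set (ℂˣ →* Points A ℝ)) (γ : Gal(F/ℚ)) :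
    ∀ y ∈ resDatum F X, (gal A F ℝ γ).toMonoidHom.comp y ∈ resDatum F X := by
  rintro _ ⟨h, hh, g, rfl⟩
  refine ⟨h, hh, gal A F ℝ γ g, MonoidHom.ext fun z => ?_⟩
  change gal A F ℝ γ (g * toRes F (h z) * g⁻¹) = gal A F ℝ γ g * toRes F (h z) * (gal A F ℝ γ g)⁻¹
  rw [map_mul, map_mul, map_inv, gal_toRes]

lemma toRes_mem_resDatum (X : Set (ℂˣ →* Points A ℝ)) :
    ∀ h ∈ X, (toRes F).comp h ∈ resDatum F X :=
  fun h hh => ⟨h, hh, 1, MonoidHom.ext fun z => by simp⟩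

lemma IsShimuraDatum.conj_mem {X : Set (ℂˣ →* Points A ℝ)} (hX : IsShimuraDatum A X)
    (g : Points A ℝ) : ∀ h ∈ X, conjHom g h ∈ X := by
  obtain ⟨h₀, rfl⟩ := hX.conjClass
  rintro _ ⟨g', rfl⟩
  exact ⟨g * g', MonoidHom.ext fun z => by simp [mul_assoc]⟩

/-- The topology on `H(𝔸_f) = G(𝔸_f ⊗ F)`, where `𝔸_f ⊗ F` is topologized as a finite free
`𝔸_f`-module. -/
@[reducible] def adelicTopology : TopologicalSpace (ResPoints A F Af) :=
  letI : TopologicalSpace (Af ⊗[ℚ] F) := moduleTopology Af (Af ⊗[ℚ] F)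
  inferInstance

variable {F}

/-- The subgroup `K ⊆ H(𝔸_f)` is stable under `Γ`. -/
def IsGalStable (K : Subgroup (ResPoints A F Af)) : Prop :=
  ∀ γ : Gal(F/ℚ), ∀ k ∈ K, gal A F Af γ k ∈ K

/-- A good compact open subgroup `K` of `H(𝔸_f)`: it is compact, open and `Γ`-stable, and
`H¹(Γ, K) = {1}`. (The Krull topology of the finite group `Γ` is discrete.) -/
structure IsGood (K : Subgroup (ResPoints A F Af)) : Prop where
  stable : IsGalStable K
  isCompact : @IsCompact _ (adelicTopology F) (K : Set (ResPoints A F Af))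
  isOpen : @IsOpen _ (adelicTopology F) (K : Set (ResPoints A F Af))
  h1 : ∀ x : H1 (restrictAction (gal A F Af) K stable), x = 1

/-- `K^Γ = K ∩ G(𝔸_f)`, as a subgroup of `G(𝔸_f)`. -/
abbrev fixedLevel (K : Subgroup (ResPoints A F Af)) : Subgroup (Points A Af) :=
  K.comap (toRes F)

/-- The action of `G(ℚ)` on `X × G(𝔸_f)/K^Γ`. -/
def baseAction {X : Set (ℂˣ →* Points A ℝ)} (hX : IsShimuraDatum A X)
    (K : Subgroup (ResPoints A F Af)) :
    Points A ℚ →* Equiv.Perm (LevelSpace X (fixedLevel K)) :=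
  levelAction (Points.map (algebraMap ℚ ℝ)) (Points.map (algebraMap ℚ Af)) X hX.conj_mem
    (fixedLevel K)

/-- The action of `H(ℚ)` on `Y × H(𝔸_f)/K`. -/
def resAction (X : Set (ℂˣ →* Points A ℝ)) (K : Subgroup (ResPoints A F Af)) :
    ResPoints A F ℚ →* Equiv.Perm (LevelSpace (resDatum F X) K) :=
  levelAction (ResPoints.map F (algebraMap ℚ ℝ)) (ResPoints.map F (algebraMap ℚ Af))
    (resDatum F X) (conj_mem_resDatum F X) K

/-- The groupoid `[G(ℚ) \ (X × G(𝔸_f)/K^Γ)]`. -/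
abbrev BaseGroupoid {X : Set (ℂˣ →* Points A ℝ)} (hX : IsShimuraDatum A X)
    (K : Subgroup (ResPoints A F Af)) := ActionGroupoid (baseAction hX K)

/-- The groupoid `[H(ℚ) \ (Y × H(𝔸_f)/K)]`. -/
abbrev ResGroupoid (X : Set (ℂˣ →* Points A ℝ)) (K : Subgroup (ResPoints A F Af)) :=
  ActionGroupoid (resAction X K)

/-- The action of `Γ` on `Y × H(𝔸_f)/K`. -/
def galLevel (X : Set (ℂˣ →* Points A ℝ)) {K : Subgroup (ResPoints A F Af)} (hK : IsGalStable K) :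
    Gal(F/ℚ) →* Equiv.Perm (LevelSpace (resDatum F X) K) :=
  levelGal (gal A F ℝ) (gal A F Af) (resDatum F X) (gal_mem_resDatum F X) K hK

/-- The action of `Γ` on `[H(ℚ) \ (Y × H(𝔸_f)/K)]`. -/
def galAction (X : Set (ℂˣ →* Points A ℝ)) {K : Subgroup (ResPoints A F Af)} (hK : IsGalStable K) :
    WeakAction Gal(F/ℚ) (ResGroupoid X K) :=
  ActionGroupoid.weakAction (gal A F ℚ) (galLevel X hK)
    (levelGal_levelAction _ _ _ _ _ _ _ _ _ _ (fun γ q => gal_map F (algebraMap ℚ ℝ) γ q)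
      (fun γ q => gal_map F (algebraMap ℚ Af) γ q))

/-- The natural functor
`[G(ℚ) \ (X × G(𝔸_f)/K^Γ)] → [H(ℚ) \ (Y × H(𝔸_f)/K)]^{hΓ}`, induced by the embedding `G → H`. -/
def naturalFunctor {X : Set (ℂˣ →* Points A ℝ)} (hX : IsShimuraDatum A X)
    {K : Subgroup (ResPoints A F Af)} (hK : IsGalStable K) :
    BaseGroupoid hX K ⥤ HomotopyFixedPoints (galAction X hK) :=
  ActionGroupoid.toHomotopyFixedPoints (gal A F ℚ) (galLevel X hK) _
    (toRes F : Points A ℚ →* ResPoints A F ℚ)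
    (levelMap (toRes F) (toRes F) X (resDatum F X) (toRes_mem_resDatum F X) K)
    (levelMap_levelAction _ _ _ _ _ _ _ _ _ _ _ _ _
      (fun g => toRes_map F (algebraMap ℚ ℝ) g) (fun g => toRes_map F (algebraMap ℚ Af) g))
    (gal_toRes F)
    (levelGal_levelMap _ _ _ _ _ _ _ _ _ _ (gal_toRes F) (gal_toRes F))

end Adelic

end ShimuraFixedPoints

end

open ShimuraFixedPoints

namespace ShimuraFixedPoints

/-! ### Points with coordinates in a subring, and points over a product of rings -/

section PointsLemmas

variable {A : Type*} [CommRing A] [HopfAlgebra ℚ A] {R : Type*} [CommRing R] [Algebra ℚ R]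
  {S : Type*} [CommRing S] [Algebra ℚ S]

/-! Full faithfulness is Galois descent: `H(R)^Γ = G(R)` for every `ℚ`-algebra `R`
(`exists_toRes_eq`). A morphism between images, where the `τ_γ` are identities, is a `Γ`-fixed
element of `H(ℚ)`, so it lies in `G(ℚ)`; and `X × G(𝔸_f)/K^Γ` embeds in `Y × H(𝔸_f)/K`.

For essential surjectivity, a homotopy fixed point is a point `(y, pK)` with elements `t_γ` of
`H(ℚ)` carrying it to its conjugates, and `c_γ = t_γ⁻¹` is a `1`-cocycle. It splits over `𝔸_f`,
because `p⁻¹ c_γ γ(p)` is a cocycle in `K` and `H¹(Γ, K)` is trivial (`exists_mem_eq_coboundary`).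
It splits over `ℝ`, because for `y = g h g⁻¹` the cocycle `g⁻¹ c_γ γ(g)` centralizes `h`, and as `ℝ
⊗ F = ℝ^Γ` for totally real `F`, this centralizer in `H(ℝ)` is induced
(`exists_commute_eq_coboundary`, `exists_eq_conjHom_of_isTotallyReal`). So the inflation of `c` to
`H¹(ℚ, G)` lies in `Ш¹(ℚ, G)`. It dies over `F`, hence is trivial by hypothesis, and inflation has
trivial kernel: `c_γ = m γ(m)⁻¹` with `m ∈ H(ℚ)` (`exists_eq_coboundary`).

The local splittings can be chosen so that they also move `h` to `y` and represent `pK`. Dividing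
them by `m` gives `Γ`-fixed elements, that is, points of `G(ℝ)` and `G(𝔸_f)`. These define an object
of the source, and `m` is the isomorphism from its image. -/

lemma Points.map_injective {f : R →+* S} (hf : Function.Injective f) :
    Function.Injective (Points.map (A := A) f) := fun g h hgh =>
  Points.ext fun a => hf (by rw [← Points.eval_map, hgh, Points.eval_map])

/-- A point all of whose coordinates lie in a subring is a point of this subring. -/
lemma Points.exists_map_eq {f : R →+* S} (hf : Function.Injective f) (g : Points A S)
    (hg : ∀ a, g.eval a ∈ Set.range f) : ∃ g' : Points A R, Points.map f g' = g := by
  let e := AlgEquiv.ofInjective f.toRatAlgHom hf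
  let φ : A →ₐ[ℚ] f.toRatAlgHom.range := g.eval.codRestrict _ (fun a => hg a)
  refine ⟨WithConv.toConv (e.symm.toAlgHom.comp φ), Points.ext fun a => ?_⟩
  exact congrArg Subtype.val (e.apply_symm_apply (φ a))

/-- `G(∏ R) = ∏ G(R)`. -/
lemma Points.exists_of_ringEquiv_pi {ι : Type*} (e : S ≃+* (ι → R)) (g : ι → Points A R) :
    ∃ g' : Points A S, ∀ i, Points.map ((Pi.evalRingHom (fun _ => R) i).comp (e : S →+* (ι → R))) g'
      = g i :=
  ⟨WithConv.toConv ((e.symm : (ι → R) →+* S).toRatAlgHom.comp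
      (AlgHom.pi fun i => (g i).eval)), fun i => Points.ext fun a =>
    congrFun (e.apply_symm_apply fun j => (g j).eval a) i⟩

end PointsLemmas

/-! ### Galois descent from `R ⊗ F` to `R` -/

section Invariants

variable (F : Type*) [Field F] [NumberField F] {R : Type*} [CommRing R] [Algebra ℚ R]

lemma includeLeft_injective :
    Function.Injective (Algebra.TensorProduct.includeLeft : R →ₐ[ℚ] R ⊗[ℚ] F) :=
  Algebra.TensorProduct.includeLeft_injective (algebraMap ℚ F).injective

variable {A : Type*} [CommRing A] [HopfAlgebra ℚ A]

lemma toRes_injective : Function.Injective (toRes F : Points A R →* ResPoints A F R) :=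
  Points.map_injective (includeLeft_injective F)

variable [IsGalois ℚ F]

-- The sum of the conjugates in `F` is the trace, so it is rational and can be moved across the
-- tensor sign. This is the averaging operator that produces invariants.
open Classical in
lemma sum_galRingAut (x : R ⊗[ℚ] F) :
    ∑ γ : Gal(F/ℚ), galRingAut F R γ x =
      (LinearMap.lTensor R (Algebra.trace ℚ F) x |> TensorProduct.rid ℚ R) ⊗ₜ[ℚ] (1 : F) := by
  induction x with
  | zero => simp
  | add x y hx hy => simp only [map_add, Finset.sum_add_distrib, hx, hy, add_tmul]
  | tmul r f =>
    change ∑ γ : Gal(F/ℚ), r ⊗ₜ[ℚ] γ f = _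
    rw [← tmul_sum, ← trace_eq_sum_automorphisms]
    simp [smul_tmul]

/-- The `Γ`-invariants of `R ⊗ F` are `R`. -/
lemma mem_range_includeLeft (x : R ⊗[ℚ] F) (hx : ∀ γ : Gal(F/ℚ), galRingAut F R γ x = x) :
    x ∈ Set.range (Algebra.TensorProduct.includeLeft : R →ₐ[ℚ] R ⊗[ℚ] F).toRingHom := by
  classical
  have h := sum_galRingAut F x
  -- For invariant `x` the sum is `|Γ| • x`, and `|Γ|` is invertible in `ℚ`.
  rw [Finset.sum_congr rfl fun γ _ => hx γ, Finset.sum_const, Finset.card_univ] at h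
  have hn : ((Fintype.card Gal(F/ℚ) : ℕ) : ℚ) ≠ 0 := Nat.cast_ne_zero.2 Fintype.card_ne_zero
  rw [← Nat.cast_smul_eq_nsmul ℚ] at h
  refine ⟨((Fintype.card Gal(F/ℚ) : ℕ) : ℚ)⁻¹ •
    (LinearMap.lTensor R (Algebra.trace ℚ F) x |> TensorProduct.rid ℚ R), ?_⟩
  change (_ • _) ⊗ₜ[ℚ] (1 : F) = x
  rw [← smul_tmul', ← h, smul_smul, inv_mul_cancel₀ hn, one_smul]

/-- `H(R)^Γ = G(R)`. -/
lemma exists_toRes_eq (g : ResPoints A F R) (hg : ∀ γ, gal A F R γ g = g) :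
    ∃ g' : Points A R, toRes F g' = g :=
  Points.exists_map_eq (includeLeft_injective F) g fun a =>
    mem_range_includeLeft F _ fun γ => by
      conv_rhs => rw [← hg γ]
      rfl

end Invariants

/-! ### Splitting of `E ⊗ F` over a field containing `F` -/

section Split

variable {F : Type*} [Field F] [NumberField F]

/-- The homomorphism `R ⊗ F → S` given by homomorphisms `f : R → S` and `ι : F → S`. -/
noncomputable def liftTensor {R S : Type*} [CommRing R] [Algebra ℚ R] [CommRing S] [Algebra ℚ S]
    (f : R →+* S) (ι : F →+* S) : R ⊗[ℚ] F →+* S :=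
  (Algebra.TensorProduct.lift f.toRatAlgHom ι.toRatAlgHom fun _ _ => mul_comm _ _).toRingHom

@[simp] lemma liftTensor_tmul {R S : Type*} [CommRing R] [Algebra ℚ R] [CommRing S] [Algebra ℚ S]
    (f : R →+* S) (ι : F →+* S) (r : R) (x : F) : liftTensor f ι (r ⊗ₜ x) = f r * ι x :=
  Algebra.TensorProduct.lift_tmul _ _ _ _ _

lemma ringHom_tensor_ext {R S : Type*} [CommRing R] [Algebra ℚ R] [CommRing S]
    {f g : R ⊗[ℚ] F →+* S} (h : ∀ r x, f (r ⊗ₜ x) = g (r ⊗ₜ x)) : f = g :=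
  RingHom.ext fun x => by
    induction x with
    | zero => simp
    | add x y hx hy => rw [map_add, map_add, hx, hy]
    | tmul r x => exact h r x

lemma galRingAut_tmul {R : Type*} [CommRing R] [Algebra ℚ R] (γ : Gal(F/ℚ)) (r : R) (x : F) :
    galRingAut F R γ (r ⊗ₜ x) = r ⊗ₜ γ x := rfl

variable [IsGalois ℚ F] (E : Type*) [Field E] [Algebra ℚ E]

/-- If `E` contains the Galois extension `F` of `ℚ`, then `E ⊗ F` is the product of copies of `E`
indexed by `Gal(F/ℚ)`. -/
lemma exists_ringEquiv_pi (ι : F →+* E) :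
    ∃ e : E ⊗[ℚ] F ≃+* (Gal(F/ℚ) → E), ∀ γ x,
      e x γ = liftTensor (RingHom.id E) ι (galRingAut F E γ x) := by
  classical
  let φ : E ⊗[ℚ] F →+* (Gal(F/ℚ) → E) := RingHom.pi fun γ =>
    (liftTensor (RingHom.id E) ι).comp (galRingAut F E γ : E ⊗[ℚ] F →+* E ⊗[ℚ] F)
  let ψ : E ⊗[ℚ] F →ₗ[E] (Gal(F/ℚ) → E) :=
    { φ with
      map_smul' := fun r x => by
        change φ (r • x) = r • φ x
        rw [Algebra.smul_def, map_mul]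
        funext γ
        change liftTensor (RingHom.id E) ι (galRingAut F E γ (r ⊗ₜ 1)) * φ x γ = r * φ x γ
        rw [galRingAut_tmul, liftTensor_tmul, map_one, map_one, mul_one]
        rfl }
  -- Dedekind's independence of characters, applied to the embeddings `ι ∘ γ`.
  have hind : LinearIndependent E (fun γ : Gal(F/ℚ) => fun x : F => ι (γ x)) := by
    refine (linearIndependent_monoidHom F E).comp
      (fun γ : Gal(F/ℚ) => (ι : F →* E).comp (γ : F →* F)) fun γ γ' h => ?_
    exact AlgEquiv.ext fun x => ι.injective (DFunLike.congr_fun h x)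
  have hsurj : Function.Surjective ψ := by
    rw [← LinearMap.range_eq_top]
    by_contra hne
    -- A linear form vanishing on a proper image would be a linear relation among the `ι ∘ γ`.
    obtain ⟨f, hf0, hf⟩ := Submodule.exists_le_ker_of_lt_top _ (lt_top_iff_ne_top.2 hne)
    apply hf0
    have key : ∀ x : F, ∑ γ : Gal(F/ℚ), f (Pi.single γ 1) * ι (γ x) = 0 := by
      intro x
      have h1 : f (ψ (1 ⊗ₜ x)) = 0 := hf ⟨_, rfl⟩
      rw [← h1, LinearMap.pi_apply_eq_sum_univ f]
      refine Finset.sum_congr rfl fun γ _ => ?_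
      have : ψ (1 ⊗ₜ x) γ = ι (γ x) := by
        change liftTensor (RingHom.id E) ι (galRingAut F E γ (1 ⊗ₜ x)) = _
        rw [galRingAut_tmul, liftTensor_tmul, map_one, one_mul]
      rw [this, smul_eq_mul, mul_comm]
      congr 3
      funext i
      simp [Pi.single_apply, eq_comm]
    have h0 := Fintype.linearIndependent_iff.1 hind (fun γ => f (Pi.single γ 1)) (by
      funext x
      simpa using key x)
    refine LinearMap.pi_ext' fun γ => LinearMap.ext_ring ?_
    simpa using h0 γ
  have hdim : Module.finrank E (E ⊗[ℚ] F) = Module.finrank E (Gal(F/ℚ) → E) := by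
    rw [Module.finrank_baseChange, Module.finrank_fintype_fun_eq_card, ← Nat.card_eq_fintype_card,
      IsGalois.card_aut_eq_finrank]
  have hinj : Function.Injective ψ :=
    (LinearMap.injective_iff_surjective_of_finrank_eq_finrank hdim).2 hsurj
  exact ⟨RingEquiv.ofBijective φ ⟨hinj, hsurj⟩, fun _ _ => rfl⟩

end Split

/-! ### Two sources of coboundaries: subgroups with trivial `H¹`, and induced groups -/

section Coboundaries

/-- A cocycle with values in `P` that becomes a cocycle in `K` after translation by `g` is a
coboundary if `H¹(Γ, K)` is trivial. -/
lemma exists_mem_eq_coboundary {Γ P : Type*} [Group Γ] [TopologicalSpace Γ] [DiscreteTopology Γ]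
    [Group P] (α : Γ →* MulAut P) (K : Subgroup P) (hK : ∀ γ, ∀ k ∈ K, α γ k ∈ K)
    (h1 : ∀ x : H1 (restrictAction α K hK), x = 1) (c : Γ → P)
    (hc : ∀ a b, c (a * b) = c a * α a (c b)) (g : P) (hg : ∀ γ, g⁻¹ * c γ * α γ g ∈ K) :
    ∃ k ∈ K, ∀ γ, c γ = g * k * (α γ (g * k))⁻¹ := by
  let d : Cocycle (restrictAction α K hK) := ⟨fun γ => ⟨_, hg γ⟩, fun a b => Subtype.ext (by
    change g⁻¹ * c (a * b) * α (a * b) g = g⁻¹ * c a * α a g * α a (g⁻¹ * c b * α b g)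
    simp only [hc, map_mul, map_inv, MulAut.mul_apply]
    group), IsLocallyConstant.of_discrete _⟩
  obtain ⟨k, hk⟩ := Quotient.exact (h1 (Quotient.mk (cohomologous _) d))
  -- The relation with the trivial cocycle reads `1 = k d_γ γ(k)⁻¹`, so it is `k⁻¹` that splits `d`.
  refine ⟨(k⁻¹ : K), (k⁻¹).2, fun γ => ?_⟩
  have h : (1 : P) = k * (g⁻¹ * c γ * α γ g) * (α γ k)⁻¹ := congrArg Subtype.val (hk γ)
  have h' : c γ = g * (k : P)⁻¹ * 1 * α γ k * (α γ g)⁻¹ := by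
    rw [h]; group
  rw [h']
  simp [mul_assoc]

variable {A : Type*} [CommRing A] [HopfAlgebra ℚ A] {F : Type*} [Field F] [NumberField F]
  [IsGalois ℚ F]

/-- If `E` contains `F`, then `H(E) = ∏ G(E)` is an induced group, and so is the centralizer in
`H(E)` of a subset of `G(E)`. Hence cocycles with values in this centralizer are coboundaries. -/
lemma exists_commute_eq_coboundary {E : Type*} [Field E] [Algebra ℚ E] (ι : F →+* E)
    (T : Set (Points A E)) (c : Gal(F/ℚ) → ResPoints A F E)
    (hc : ∀ a b, c (a * b) = c a * gal A F E a (c b))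
    (hT : ∀ γ, ∀ t ∈ T, Commute (c γ) (toRes F t)) :
    ∃ w : ResPoints A F E, (∀ t ∈ T, Commute w (toRes F t)) ∧
      ∀ γ, c γ = w * (gal A F E γ w)⁻¹ := by
  obtain ⟨e, he⟩ := exists_ringEquiv_pi E ι
  let π : ResPoints A F E →* Points A E := Points.map (liftTensor (RingHom.id E) ι)
  have hπ : ∀ (γ : Gal(F/ℚ)) (x : ResPoints A F E),
      Points.map ((Pi.evalRingHom (fun _ => E) γ).comp (e : E ⊗[ℚ] F →+* (Gal(F/ℚ) → E))) x =
        π (gal A F E γ x) := fun γ x => Points.ext fun a => he γ _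
  have hinj : ∀ x y : ResPoints A F E, (∀ γ, π (gal A F E γ x) = π (gal A F E γ y)) → x = y := by
    refine fun x y h => Points.ext fun a => e.injective (funext fun γ => ?_)
    rw [he, he]
    exact congrArg (fun p : Points A E => p.eval a) (h γ)
  have hres : ∀ t : Points A E, π (toRes F t) = t := fun t => Points.ext fun a => by
    change liftTensor (RingHom.id E) ι (t.eval a ⊗ₜ 1) = _
    rw [liftTensor_tmul, map_one, mul_one, RingHom.id_apply]
  -- As in Shapiro's lemma: `x ↦ π(γ x)` is the `γ`-coordinate on `H(E) = ∏ G(E)`, and `z` is built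
  -- with `γ`-coordinate `π(c γ)`. The cocycle rule then gives `c γ = z⁻¹ γ(z)` coordinatewise.
  obtain ⟨z, hz⟩ := Points.exists_of_ringEquiv_pi e fun γ => π (c γ)
  replace hz : ∀ γ, π (gal A F E γ z) = π (c γ) := fun γ => (hπ γ z).symm.trans (hz γ)
  -- All coordinates of `toRes F t` equal `t`, so commutation can be checked on each `c γ`.
  have hzT : ∀ t ∈ T, Commute z (toRes F t) := fun t ht => hinj _ _ fun γ => by
    rw [map_mul, map_mul, map_mul, map_mul, hz, gal_toRes, ← map_mul, ← map_mul]
    exact congrArg π (hT γ t ht)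
  refine ⟨z⁻¹, fun t ht => (hzT t ht).inv_left, fun γ => ?_⟩
  rw [map_inv, inv_inv]
  refine hinj _ _ fun δ => ?_
  have h1 : gal A F E δ (gal A F E γ z) = gal A F E (δ * γ) z := by rw [map_mul]; rfl
  rw [map_mul, map_mul, h1, hz, hc, map_mul, map_inv, map_inv, hz]
  group

end Coboundaries

/-! ### From cocycles of `Gal(F/ℚ)` to Galois cohomology and `Ш¹` -/

section Inflation

variable {F : Type*} [Field F] [NumberField F] {A : Type*} [CommRing A] [HopfAlgebra ℚ A]

/-- Translates the action of `Γ` on `H(R)` into that of an absolute Galois group: `σ` fixes the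
image of `R` and induces `γ` on `F`, so both sides agree on pure tensors. -/
lemma map_liftTensor_gal {R S : Type*} [CommRing R] [Algebra ℚ R] [CommRing S] [Algebra ℚ S]
    (f : R →+* S) (ι : F →+* S) (σ : S →+* S) (γ : Gal(F/ℚ)) (hf : ∀ r, σ (f r) = f r)
    (hι : ∀ x, ι (γ x) = σ (ι x)) (g : ResPoints A F R) :
    Points.map (liftTensor f ι) (gal A F R γ g) = Points.map σ (Points.map (liftTensor f ι) g) := by
  have h : (liftTensor f ι).comp (galRingAut F R γ : R ⊗[ℚ] F →+* R ⊗[ℚ] F) =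
      σ.comp (liftTensor f ι) := ringHom_tensor_ext fun r x => by
    change liftTensor f ι (r ⊗ₜ γ x) = σ (liftTensor f ι (r ⊗ₜ x))
    rw [liftTensor_tmul, liftTensor_tmul, map_mul, hf, hι]
  exact Points.ext fun a => DFunLike.congr_fun h _

lemma liftTensor_rat_injective {S : Type*} [CommRing S] [Nontrivial S] [Algebra ℚ S]
    (ι : F →+* S) : Function.Injective (liftTensor (algebraMap ℚ S) ι) := by
  have : liftTensor (algebraMap ℚ S) ι =
      ι.comp (Algebra.TensorProduct.lid ℚ F : ℚ ⊗[ℚ] F →+* F) := ringHom_tensor_ext fun r x => by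
    change _ = ι (r • x)
    rw [liftTensor_tmul, Algebra.smul_def, map_mul]
    congr 1
    exact DFunLike.congr_fun (Subsingleton.elim (algebraMap ℚ S) (ι.comp (algebraMap ℚ F))) r
  rw [this]
  exact ι.injective.comp (Algebra.TensorProduct.lid ℚ F).injective

lemma isScalarTower_rat {E : Type*} [Field E] [Algebra ℚ E] (ι : F →+* E) :
    letI := ι.toAlgebra
    IsScalarTower ℚ F E :=
  letI := ι.toAlgebra
  ⟨fun q x y => by
    change ι (q • x) * y = q • (ι x * y)
    rw [map_rat_smul, smul_mul_assoc]⟩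

variable [IsGalois ℚ F] {k : Type*} [Field k] [Algebra ℚ k]

/-- The restriction `Gal(k̄/k) → Gal(F/ℚ)` along an embedding `F → k̄`. -/
noncomputable def restrictGal (ι : F →+* AlgebraicClosure k) :
    Gal(AlgebraicClosure k/k) →* Gal(F/ℚ) :=
  letI : Algebra F (AlgebraicClosure k) := ι.toAlgebra
  haveI := isScalarTower_rat ι
  (AlgEquiv.restrictNormalHom (F := ℚ) (K₁ := AlgebraicClosure k) F).comp
    (AlgEquiv.restrictScalarsHom ℚ)

lemma restrictGal_apply (ι : F →+* AlgebraicClosure k) (σ : Gal(AlgebraicClosure k/k)) (x : F) :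
    ι (restrictGal ι σ x) = σ (ι x) := by
  let _ : Algebra F (AlgebraicClosure k) := ι.toAlgebra
  have _ := isScalarTower_rat ι
  exact AlgEquiv.restrictNormal_commutes (σ.restrictScalars ℚ) F x

/-- The hypothesis makes `k` a copy of `ℚ`. Then `k̄` is normal over `ℚ`, so every automorphism of
`F` extends to `k̄`, and the extension automatically fixes `k`. -/
lemma restrictGal_surjective (hk : Function.Surjective (algebraMap ℚ k))
    (ι : F →+* AlgebraicClosure k) : Function.Surjective (restrictGal ι) := by
  let _ : Algebra F (AlgebraicClosure k) := ι.toAlgebra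
  have _ := isScalarTower_rat ι
  have _ : Algebra.IsAlgebraic ℚ k := ⟨fun x => by
    obtain ⟨q, rfl⟩ := hk x
    exact isAlgebraic_algebraMap q⟩
  have _ : Algebra.IsAlgebraic ℚ (AlgebraicClosure k) := Algebra.IsAlgebraic.trans ℚ k _
  have _ : IsAlgClosure ℚ (AlgebraicClosure k) := ⟨inferInstance, inferInstance⟩
  have _ : Normal ℚ (AlgebraicClosure k) := IsAlgClosure.normal ℚ _
  intro γ
  obtain ⟨σ, rfl⟩ := AlgEquiv.restrictNormalHom_surjective (F := ℚ) (K₁ := F) (AlgebraicClosure k) γ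
  refine ⟨AlgEquiv.ofRingEquiv (f := σ.toRingEquiv) fun x => ?_, AlgEquiv.ext fun x => ?_⟩
  · obtain ⟨q, rfl⟩ := hk x
    rw [← IsScalarTower.algebraMap_apply]
    exact σ.commutes q
  · exact ι.injective ((restrictGal_apply ι _ x).trans
      (AlgEquiv.restrictNormal_commutes σ F x).symm)

/-- The restriction to `F` is determined by the images of a finite basis, and each of these has an
open stabilizer. -/
lemma isLocallyConstant_restrictGal (ι : F →+* AlgebraicClosure k) :
    IsLocallyConstant (restrictGal ι) := by
  refine (IsLocallyConstant.iff_eventually_eq _).2 fun σ => ?_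
  let b := Module.finBasis ℚ F
  have key : ∀ i, ∀ᶠ τ in nhds σ, τ (ι (b i)) = σ (ι (b i)) := by
    intro i
    have h1 := (stabilizer_isOpen_of_isIntegral (K := k) (ι (b i))).preimage
      (continuous_const_mul σ⁻¹)
    filter_upwards [h1.mem_nhds (by simp)] with τ hτ
    have h2 : σ.symm (τ (ι (b i))) = ι (b i) := hτ
    rw [← σ.symm_apply_eq, h2]
  filter_upwards [Filter.eventually_all.2 key] with τ hτ
  refine AlgEquiv.toLinearMap_injective (b.ext fun i => ι.injective ?_)
  exact (restrictGal_apply ι τ _).trans ((hτ i).trans (restrictGal_apply ι σ _).symm)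

/-- The image in `H¹(k, G)` of a cocycle of `Gal(F/ℚ)` with values in `H(ℚ) = G(F)`. -/
noncomputable def inflation (ι : F →+* AlgebraicClosure k) (c : Gal(F/ℚ) → ResPoints A F ℚ)
    (hc : ∀ a b, c (a * b) = c a * gal A F ℚ a (c b)) : Cocycle (galoisAction A k) :=
  ⟨fun σ => Points.map (liftTensor (algebraMap ℚ (AlgebraicClosure k)) ι) (c (restrictGal ι σ)),
    fun σ σ' => by
      have h := map_liftTensor_gal (A := A) (algebraMap ℚ (AlgebraicClosure k)) ι
        (σ : AlgebraicClosure k →+* AlgebraicClosure k) (restrictGal ι σ)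
        (fun r => (σ.restrictScalars ℚ).commutes r) (restrictGal_apply ι σ) (c (restrictGal ι σ'))
      beta_reduce
      rw [map_mul (restrictGal ι), hc, map_mul, h]
      rfl,
    (isLocallyConstant_restrictGal ι).comp fun γ =>
      Points.map (liftTensor (algebraMap ℚ (AlgebraicClosure k)) ι) (c γ)⟩

variable (k) in
lemma baseChange_one (L : Type*) [Field L] [Algebra k L] [Algebra ℚ L] :
    GaloisH1.baseChange A k L 1 = 1 :=
  Quotient.sound ⟨1, fun γ => by
    change 1 = 1 * Points.map _ 1 * _
    simp⟩

/-- A splitting over `R` can be pushed to `G(L̄)` along `R ⊗ F → L̄`. Allowing any ring `R` with a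
map to `L` covers at once `𝔸_f → ℚ_v`, `ℝ → ℚ_∞` and `F → F`. -/
lemma baseChange_inflation (ι : F →+* AlgebraicClosure k) (c : Gal(F/ℚ) → ResPoints A F ℚ)
    (hc : ∀ a b, c (a * b) = c a * gal A F ℚ a (c b)) (L : Type*) [Field L] [Algebra k L]
    [Algebra ℚ L] {R : Type*} [CommRing R] [Algebra ℚ R] (f : R →+* L) (n : ResPoints A F R)
    (hn : ∀ γ, ResPoints.map F (algebraMap ℚ R) (c γ) = n * (gal A F R γ n)⁻¹) :
    GaloisH1.baseChange A k L (Quotient.mk (cohomologous _) (inflation ι c hc)) = 1 := by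
  let f' : R →+* AlgebraicClosure L := (algebraMap L (AlgebraicClosure L)).comp f
  let κ : AlgebraicClosure k →+* AlgebraicClosure L := closureEmb k L
  let ι' : F →+* AlgebraicClosure L := κ.comp ι
  -- The two routes from `ℚ ⊗ F` to `L̄` agree on `F` by the choice of `ι'`, and on `ℚ` because ring
  -- maps out of `ℚ` are unique.
  have key : ∀ x : ResPoints A F ℚ,
      Points.map κ (Points.map (liftTensor (algebraMap ℚ (AlgebraicClosure k)) ι) x) =
      Points.map (liftTensor f' ι') (ResPoints.map F (algebraMap ℚ R) x) := by
    intro x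
    have h : κ.comp (liftTensor (algebraMap ℚ (AlgebraicClosure k)) ι) =
        (liftTensor f' ι').comp (Algebra.TensorProduct.map (algebraMap ℚ R).toRatAlgHom
          (AlgHom.id ℚ F) : ℚ ⊗[ℚ] F →+* R ⊗[ℚ] F) := ringHom_tensor_ext fun r x => by
      change κ (liftTensor _ ι (r ⊗ₜ x)) = liftTensor f' ι' (algebraMap ℚ R r ⊗ₜ x)
      rw [liftTensor_tmul, liftTensor_tmul, map_mul]
      congr 1
      exact DFunLike.congr_fun (Subsingleton.elim (κ.comp (algebraMap ℚ _))
        (f'.comp (algebraMap ℚ R))) r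
    exact Points.ext fun a => DFunLike.congr_fun h _
  refine Quotient.sound ⟨(Points.map (liftTensor f' ι') n)⁻¹, fun σ => ?_⟩
  have h1 := key (c (restrictGal ι (galoisRes k L σ)))
  have h2 := map_liftTensor_gal (A := A) f' ι'
    (σ : AlgebraicClosure L →+* AlgebraicClosure L) (restrictGal ι (galoisRes k L σ))
    (fun r => σ.commutes (f r)) (fun x => by
      change closureEmb k L (ι _) = σ (closureEmb k L (ι x))
      rw [restrictGal_apply, closureEmb_galoisRes]) n
  rw [hn, map_mul, map_inv, h2] at h1
  change 1 = (Points.map (liftTensor f' ι') n)⁻¹ *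
    Points.map κ (Points.map _ (c (restrictGal ι (galoisRes k L σ)))) *
    (Points.map (σ : AlgebraicClosure L →+* AlgebraicClosure L)
      (Points.map (liftTensor f' ι') n)⁻¹)⁻¹
  rw [h1, map_inv]
  group

/-- Infinite Galois theory: `k̄/k` is Galois in characteristic zero, and the image of `F` is the
fixed field of its fixing subgroup. -/
lemma mem_range_of_restrictGal (hk : Function.Surjective (algebraMap ℚ k))
    (ι : F →+* AlgebraicClosure k) (y : AlgebraicClosure k)
    (hy : ∀ σ : Gal(AlgebraicClosure k/k), restrictGal ι σ = 1 → σ y = y) : y ∈ Set.range ι := by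
  let E : IntermediateField k (AlgebraicClosure k) := ι.fieldRange.toIntermediateField fun x => by
    obtain ⟨q, rfl⟩ := hk x
    exact ⟨(q : F), by simp⟩
  have h : y ∈ IntermediateField.fixedField E.fixingSubgroup := by
    rw [IntermediateField.mem_fixedField_iff]
    refine fun σ hσ => hy σ (AlgEquiv.ext fun x => ι.injective ?_)
    rw [restrictGal_apply]
    exact (IntermediateField.mem_fixingSubgroup_iff _ _).1 hσ _ ⟨x, rfl⟩
  have := algebraRat.charZero k
  rw [InfiniteGalois.fixedField_fixingSubgroup] at h
  exact h

/-- A cocycle of `Gal(F/ℚ)` whose inflation is trivial is trivial. -/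
lemma exists_eq_coboundary_of_inflation (hk : Function.Surjective (algebraMap ℚ k))
    (ι : F →+* AlgebraicClosure k)
    (c : Gal(F/ℚ) → ResPoints A F ℚ) (hc : ∀ a b, c (a * b) = c a * gal A F ℚ a (c b))
    (h : @Eq (GaloisH1 A k) (Quotient.mk (cohomologous _) (inflation ι c hc)) 1) :
    ∃ m : ResPoints A F ℚ, ∀ γ, c γ = m * (gal A F ℚ γ m)⁻¹ := by
  let j := liftTensor (algebraMap ℚ (AlgebraicClosure k)) ι
  have hj : Function.Injective j := liftTensor_rat_injective ι
  obtain ⟨m, hm⟩ := Quotient.exact h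
  replace hm : ∀ σ : Gal(AlgebraicClosure k/k), 1 = m * Points.map j (c (restrictGal ι σ)) *
    (Points.map (σ : AlgebraicClosure k →+* AlgebraicClosure k) m)⁻¹ := hm
  have hc1 : c 1 = 1 := by simpa using hc 1 1
  -- If `σ` is trivial on `F`, the inflated cocycle is `1` at `σ`, so `σ` fixes `m`. Hence `m` has
  -- coordinates in `F` and comes from `H(ℚ) = G(F)`.
  have hmem : ∀ a, m.eval a ∈ Set.range j := by
    intro a
    obtain ⟨x, hx⟩ := mem_range_of_restrictGal hk ι (m.eval a) fun σ hσ => by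
      have h2 := hm σ
      rw [hσ, hc1, map_one, mul_one] at h2
      conv_rhs => rw [mul_inv_eq_one.1 h2.symm]
      rfl
    refine ⟨1 ⊗ₜ x, ?_⟩
    rw [liftTensor_tmul, map_one, one_mul, hx]
  obtain ⟨n, rfl⟩ := Points.exists_map_eq hj m hmem
  refine ⟨n⁻¹, fun γ => Points.map_injective hj ?_⟩
  obtain ⟨σ, rfl⟩ := restrictGal_surjective hk ι γ
  rw [map_inv, inv_inv, map_mul, map_inv, map_liftTensor_gal _ _
    (σ : AlgebraicClosure k →+* AlgebraicClosure k) _ (fun r => (σ.restrictScalars ℚ).commutes r)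
    (restrictGal_apply ι σ), ← mul_inv_eq_one.1 (hm σ).symm, inv_mul_cancel_left]

/-- A cocycle of `Gal(F/ℚ)` with values in `H(ℚ)` that is trivial over `𝔸_f` and over `ℝ` is
trivial, provided that `Ш¹(ℚ, G) → Ш¹(F, G)` is injective. -/
lemma exists_eq_coboundary (hSha : Set.InjOn (GaloisH1.baseChange A ℚ F) (Sha1 A ℚ))
    (c : Gal(F/ℚ) → ResPoints A F ℚ) (hc : ∀ a b, c (a * b) = c a * gal A F ℚ a (c b))
    (hf : ∃ n : ResPoints A F Af, ∀ γ,
      ResPoints.map F (algebraMap ℚ Af) (c γ) = n * (gal A F Af γ n)⁻¹)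
    (hr : ∃ n : ResPoints A F ℝ, ∀ γ,
      ResPoints.map F (algebraMap ℚ ℝ) (c γ) = n * (gal A F ℝ γ n)⁻¹) :
    ∃ m : ResPoints A F ℚ, ∀ γ, c γ = m * (gal A F ℚ γ m)⁻¹ := by
  let ι : F →+* AlgebraicClosure ℚ := (IsAlgClosed.lift : F →ₐ[ℚ] AlgebraicClosure ℚ)
  obtain ⟨nf, hf⟩ := hf
  obtain ⟨nr, hr⟩ := hr
  refine exists_eq_coboundary_of_inflation (fun x => ⟨x, by simp⟩) ι c hc (hSha
    ⟨fun v => ?_, fun v => ?_⟩ ⟨fun v => ?_, fun v => ?_⟩ ?_)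
  · let p : Af →+* v.adicCompletion ℚ := RestrictedProduct.evalRingHom _ v
    exact baseChange_inflation ι c hc _ p nf hf
  -- The infinite place of `ℚ` is real, so its completion is `ℝ`.
  · let p : ℝ →+* v.Completion := RingEquiv.toRingHom
      (InfinitePlace.Completion.ringEquivRealOfIsReal (IsTotallyReal.isReal v)).symm
    exact baseChange_inflation ι c hc _ p nr hr
  · exact baseChange_one ℚ _
  · exact baseChange_one ℚ _
  -- Over `F` itself `F ⊗ F` splits, so `H(F)` is induced and the class dies; with `T = ∅` the
  -- centralizer is all of `H(F)`.
  · obtain ⟨n, -, hn⟩ := exists_commute_eq_coboundary (RingHom.id F) ∅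
      (fun γ => ResPoints.map F (algebraMap ℚ F) (c γ))
      (fun a b => by rw [hc, map_mul, gal_map]) (by simp)
    exact (baseChange_inflation ι c hc F (RingHom.id F) n hn).trans (baseChange_one ℚ F).symm

end Inflation

/-! ### Isomorphisms of homotopy fixed points, and the archimedean component -/

/-- A morphism of homotopy fixed points is invertible if the underlying morphism is. -/
lemma HomotopyFixedPoints.nonempty_iso {Γ : Type*} [Group Γ] {C : Type*} [Category C]
    {W : WeakAction Γ C} {x y : HomotopyFixedPoints W} (f : x.pt ≅ y.pt)
    (hf : ∀ γ, f.hom ≫ (y.τ γ).hom = (x.τ γ).hom ≫ (W.act γ).map f.hom) : Nonempty (x ≅ y) :=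
  ⟨{ hom := ⟨f.hom, hf⟩
     inv := ⟨f.inv, fun γ => by
      rw [Iso.inv_comp_eq, ← Category.assoc, hf, Category.assoc, ← Functor.map_comp,
        f.hom_inv_id, CategoryTheory.Functor.map_id, Category.comp_id]⟩
     hom_inv_id := Subtype.ext f.hom_inv_id
     inv_hom_id := Subtype.ext f.inv_hom_id }⟩

/-- `H(ℝ)` is an induced group if `F` is totally real, so that a cocycle which takes a point `y` of
`Y` to its conjugates comes from a translation of `y` into `X`. -/
lemma exists_eq_conjHom_of_isTotallyReal {A : Type*} [CommRing A] [HopfAlgebra ℚ A]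
    {X : Set (ℂˣ →* Points A ℝ)} {F : Type*} [Field F] [NumberField F] [IsTotallyReal F]
    [IsGalois ℚ F] (y : ℂˣ →* ResPoints A F ℝ) (hy : y ∈ resDatum F X)
    (c : Gal(F/ℚ) → ResPoints A F ℝ) (hc : ∀ a b, c (a * b) = c a * gal A F ℝ a (c b))
    (hcy : ∀ γ z, y z * c γ = c γ * gal A F ℝ γ (y z)) :
    ∃ h ∈ X, ∃ g : ResPoints A F ℝ, y = conjHom g ((toRes F).comp h) ∧
      ∀ γ, c γ = g * (gal A F ℝ γ g)⁻¹ := by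
  obtain ⟨h, hh, g, rfl⟩ := hy
  let v : InfinitePlace F := Classical.arbitrary _
  -- Taking `T` to be the image of `h` forces `w` to centralize `h`, so `g * w` still conjugates `h`
  -- to `y` while also splitting `c`.
  obtain ⟨w, hw, hcw⟩ := exists_commute_eq_coboundary
    (InfinitePlace.embedding_of_isReal (IsTotallyReal.isReal v)) (Set.range h)
    (fun γ => g⁻¹ * c γ * gal A F ℝ γ g)
    (fun a b => by simp only [hc, map_mul, map_inv, MulAut.mul_apply]; group) (by
      rintro γ _ ⟨z, rfl⟩
      have h1 : g * toRes F (h z) * g⁻¹ * c γ =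
          c γ * (gal A F ℝ γ g * toRes F (h z) * (gal A F ℝ γ g)⁻¹) := by
        rw [← gal_toRes F γ (h z), ← map_inv, ← map_mul, ← map_mul, gal_toRes]
        exact hcy γ z
      change g⁻¹ * c γ * gal A F ℝ γ g * toRes F (h z) =
        toRes F (h z) * (g⁻¹ * c γ * gal A F ℝ γ g)
      calc _ = g⁻¹ * (c γ * (gal A F ℝ γ g * toRes F (h z) * (gal A F ℝ γ g)⁻¹)) *
            gal A F ℝ γ g := by group
        _ = _ := by rw [← h1]; group)
  refine ⟨h, hh, g * w, MonoidHom.ext fun z => ?_, fun γ => ?_⟩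
  · have h1 : w * toRes F (h z) * w⁻¹ = toRes F (h z) := by
      rw [(hw _ ⟨z, rfl⟩).eq, mul_inv_cancel_right]
    change g * toRes F (h z) * g⁻¹ = g * w * toRes F (h z) * (g * w)⁻¹
    conv_lhs => rw [← h1]
    group
  · have h1 : c γ = g * (g⁻¹ * c γ * gal A F ℝ γ g) * (gal A F ℝ γ g)⁻¹ := by group
    rw [h1, hcw, map_mul]
    group

/-! ### Faithfulness, fullness and essential surjectivity -/

section Equivalence

variable {A : Type*} [CommRing A] [HopfAlgebra ℚ A] {X : Set (ℂˣ →* Points A ℝ)}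
  (hX : IsShimuraDatum A X) {F : Type*} [Field F] [NumberField F]
  {K : Subgroup (ResPoints A F Af)}

lemma val_naturalFunctor_map (hK : IsGalStable K) {x y : BaseGroupoid hX K} (f : x ⟶ y) :
    ActionGroupoid.val ((naturalFunctor hX hK).map f).1 = toRes F (ActionGroupoid.val f) := rfl

lemma naturalFunctor_faithful (hK : IsGalStable K) : (naturalFunctor hX hK).Faithful where
  map_injective {x y f g} h := ActionGroupoid.hom_ext (toRes_injective F (by
    rw [← val_naturalFunctor_map hX hK, h, val_naturalFunctor_map]))

/-- The level on the source is the preimage of `K`, so distinct cosets stay distinct; on `X` it is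
injectivity of `G(ℝ) → H(ℝ)`. -/
lemma levelMap_injective : Function.Injective
    (levelMap (toRes F) (toRes F) X (resDatum F X) (toRes_mem_resDatum F X) K) := by
  rintro ⟨x, p⟩ ⟨y, q⟩ h
  induction p using QuotientGroup.induction_on with | H p =>
  induction q using QuotientGroup.induction_on with | H q =>
  refine levelSpace_ext (fun z => toRes_injective F ?_) ?_
  · exact DFunLike.congr_fun (congrArg (fun t => t.1.1) h) z
  · have h2 : ((toRes F p : ResPoints A F Af) : ResPoints A F Af ⧸ K) = (toRes F q : _) :=
      congrArg Prod.snd h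
    rw [QuotientGroup.eq] at h2
    refine QuotientGroup.eq.2 ?_
    rw [Subgroup.mem_comap, map_mul, map_inv]
    exact h2

variable [IsGalois ℚ F]

lemma naturalFunctor_full (hK : IsGalStable K) : (naturalFunctor hX hK).Full where
  map_surjective {x y} f := by
    obtain ⟨g, hg⟩ := exists_toRes_eq F (ActionGroupoid.val f.1) fun γ => by
      have h : 1 * ActionGroupoid.val f.1 = gal A F ℚ γ (ActionGroupoid.val f.1) * 1 :=
        congrArg ActionGroupoid.val (f.2 γ)
      rw [one_mul, mul_one] at h
      exact h.symm
    refine ⟨⟨g, levelMap_injective ?_⟩, Subtype.ext (ActionGroupoid.hom_ext hg)⟩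
    have h := ActionGroupoid.val_map_pt f.1
    rw [← hg] at h
    refine Eq.trans ?_ h
    exact levelMap_levelAction _ _ _ _ _ _ _ _ _ _ _ _ _
      (fun g => toRes_map F (algebraMap ℚ ℝ) g) (fun g => toRes_map F (algebraMap ℚ Af) g) _ _

lemma naturalFunctor_essSurj [IsTotallyReal F] (hK : IsGood K)
    (hSha : Set.InjOn (GaloisH1.baseChange A ℚ F) (Sha1 A ℚ)) :
    (naturalFunctor hX hK.stable).EssSurj where
  mem_essImage o := by
    have : DiscreteTopology Gal(F/ℚ) := krullTopology_discreteTopology_of_finiteDimensional ℚ F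
    let t : Gal(F/ℚ) → ResPoints A F ℚ := fun γ => ActionGroupoid.val (o.τ γ).hom
    have ht : ∀ a b, t (a * b) = gal A F ℚ a (t b) * t a := fun a b =>
      (one_mul (t (a * b))).symm.trans (congrArg ActionGroupoid.val (o.cocycle a b))
    have htp : ∀ γ, resAction X K (t γ) o.pt.pt = galLevel X hK.stable γ o.pt.pt := fun γ =>
      ActionGroupoid.val_map_pt (o.τ γ).hom
    -- Composition in the action groupoid multiplies in reverse order, so `t` satisfies the opposite
    -- cocycle rule and its inverse the usual one.
    have hc : ∀ a b, (t (a * b))⁻¹ = (t a)⁻¹ * gal A F ℚ a (t b)⁻¹ := fun a b => by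
      rw [ht, mul_inv_rev, map_inv]
    obtain ⟨⟨⟨y, hy⟩, p⟩, hpt⟩ : ∃ x, o.pt.pt = x := ⟨_, rfl⟩
    rw [hpt] at htp
    induction p using QuotientGroup.induction_on with | H p =>
    have htR : ∀ γ z, ResPoints.map F (algebraMap ℚ ℝ) (t γ) * y z *
        (ResPoints.map F (algebraMap ℚ ℝ) (t γ))⁻¹ = gal A F ℝ γ (y z) := fun γ z =>
      DFunLike.congr_fun (congrArg (fun x => x.1.1) (htp γ)) z
    have htA : ∀ γ, ((ResPoints.map F (algebraMap ℚ Af) (t γ) * p : ResPoints A F Af) :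
        ResPoints A F Af ⧸ K) = (gal A F Af γ p : ResPoints A F Af) := fun γ =>
      congrArg Prod.snd (htp γ)
    obtain ⟨k, hk, hkc⟩ := exists_mem_eq_coboundary (gal A F Af) K hK.stable hK.h1
      (fun γ => ResPoints.map F (algebraMap ℚ Af) (t γ)⁻¹)
      (fun a b => by rw [hc, map_mul, gal_map]) p (fun γ => by
        have h := QuotientGroup.eq.1 (htA γ)
        rwa [mul_inv_rev, ← map_inv] at h)
    obtain ⟨h, hh, g, hyg, hgc⟩ := exists_eq_conjHom_of_isTotallyReal y hy
      (fun γ => ResPoints.map F (algebraMap ℚ ℝ) (t γ)⁻¹)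
      (fun a b => by rw [hc, map_mul, gal_map]) (fun γ z => by
        rw [← htR, map_inv]; group)
    obtain ⟨m, hm⟩ : ∃ m, ∀ γ, (t γ)⁻¹ = m * (gal A F ℚ γ m)⁻¹ :=
      exists_eq_coboundary hSha (fun γ => (t γ)⁻¹) hc ⟨_, hkc⟩ ⟨_, hgc⟩
    -- Over `R`, both `m` and `n` split the same cocycle, so `m⁻¹ n` is `Γ`-fixed and descends to
    -- `G(R)`.
    have fixed : ∀ {R : Type} [CommRing R] [Algebra ℚ R] (n : ResPoints A F R),
        (∀ γ, ResPoints.map F (algebraMap ℚ R) (t γ)⁻¹ = n * (gal A F R γ n)⁻¹) →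
        ∃ r : Points A R, toRes F r = (ResPoints.map F (algebraMap ℚ R) m)⁻¹ * n := by
      intro R _ _ n hn
      refine exists_toRes_eq F _ fun γ => ?_
      have h1 := hn γ
      rw [hm, map_mul, map_inv, ← gal_map] at h1
      rw [map_mul, map_inv]
      calc _ = (ResPoints.map F (algebraMap ℚ R) m)⁻¹ * (ResPoints.map F (algebraMap ℚ R) m *
            (gal A F R γ (ResPoints.map F (algebraMap ℚ R) m))⁻¹) * gal A F R γ n := by group
        _ = _ := by rw [h1]; group
    obtain ⟨r, hr⟩ := fixed g hgc
    obtain ⟨q, hq⟩ := fixed (p * k) hkc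
    -- Here `r = m⁻¹ g` and `q = m⁻¹ p k`, so translation by `m` gives `g h g⁻¹ = y` and `p k K = p
    -- K`.
    let x : BaseGroupoid hX K := ⟨(⟨conjHom r h, hX.conj_mem _ _ hh⟩, (q : Points A Af))⟩
    have hx : resAction X K m
        (levelMap (toRes F) (toRes F) X (resDatum F X) (toRes_mem_resDatum F X) K x.pt) =
        o.pt.pt := by
      rw [hpt]
      refine levelSpace_ext (fun z => ?_) ?_
      · change ResPoints.map F (algebraMap ℚ ℝ) m * toRes F (r * h z * r⁻¹) *
          (ResPoints.map F (algebraMap ℚ ℝ) m)⁻¹ = y z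
        rw [hyg, map_mul, map_mul, map_inv, hr]
        change _ = g * toRes F (h z) * g⁻¹
        group
      · change ((ResPoints.map F (algebraMap ℚ Af) m * toRes F q : ResPoints A F Af) :
          ResPoints A F Af ⧸ K) = p
        rw [hq, mul_inv_cancel_left]
        exact (QuotientGroup.eq.2 (by simpa using hk)).symm
    let f : ((naturalFunctor hX hK.stable).obj x).pt ⟶ o.pt := ⟨m, hx⟩
    refine ⟨x, HomotopyFixedPoints.nonempty_iso (Groupoid.isoEquivHom _ _ |>.symm f) fun γ => ?_⟩
    refine ActionGroupoid.hom_ext ?_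
    -- Compatibility of `m` with the `τ_γ` is exactly `t_γ⁻¹ = m γ(m)⁻¹`.
    change t γ * m = gal A F ℚ γ m * 1
    rw [← inv_inv (t γ), hm]
    group

end Equivalence

end ShimuraFixedPoints

theorem theorem3p9 {A : Type*} [CommRing A] [HopfAlgebra ℚ A]
    {X : Set (ℂˣ →* Points A ℝ)} (hX : IsShimuraDatum A X)
    {F : Type*} [Field F] [NumberField F] [IsTotallyReal F] [IsGalois ℚ F]
    (K : Subgroup (ResPoints A F Af)) (hK : IsGood K)
    (hSha : Set.InjOn (GaloisH1.baseChange A ℚ F) (Sha1 A ℚ)) :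
    (naturalFunctor hX hK.stable).IsEquivalence where
  faithful := naturalFunctor_faithful hX hK.stable
  full := naturalFunctor_full hX hK.stable
  essSurj := naturalFunctor_essSurj hX hK hSha
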